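/- Let $\mathbb{D}$ be the open unit disc of $\mathbb{C}$ and $dA=\frac{dx\,dy}{\pi}$ the normalized area measure on it. Let $\omega\in L^1([0,1))$ be nonnegative with $\widehat{\omega}(r)=\int_r^1\omega(s)\,ds>0$ for all $0\le r<1$, extend it to $\mathbb{D}$ by $\omega(z)=\omega(|z|)$, and suppose that $\omega\in\widehat{\mathcal D}$, that is, there is a constant $C\ge 1$ such that $\widehat{\omega}(r)\le C\,\widehat{\omega}\left(\frac{1+r}{2}\right)$ for all $0\le r<1$. For $z\in\mathbb{D}$ let $B^\omega_z$ be the reproducing kernel at $z$ of the Bergman space $A^2_\omega$ of analytic functions $f$ on $\mathbb{D}$ with $\int_{\mathbb{D}}|f|^2\omega\,dA<\infty$, so that $B^\omega_z\in A^2_\omega$ and $f(z)=\int_{\mathbb{D}}f(\zeta)\overline{B^\omega_z(\zeta)}\,\omega(\zeta)\,dA(\zeta)$ for all $f\in A^2_\omega$. Let $$H_\omega(f)(z)=\int_0^1 f(t)\left(\frac1z\int_0^z B^\omega_t(u)\,du\right)\omega(t)\,dt,\qquad z\in\mathbb{D}$$ (the inner mean being $B^\omega_t(0)$ at $z=0$).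 Let $H^1$ be the Hardy space of analytic functions $f$ on $\mathbb{D}$ with $\|f\|_{H^1}=\sup_{0<r<1}\frac{1}{2\pi}\int_0^{2\pi}|f(re^{i\theta})|\,d\theta<\infty$. Then the following statements are equivalent: (i) $H_\omega:H^1\to H^1$ is bounded; that is, there is a constant $C<\infty$ such that for every $f\in H^1$ the integral defining $H_\omega(f)(z)$ converges absolutely for every $z\in\mathbb{D}$, $H_\omega(f)\in H^1$, and $\|H_\omega(f)\|_{H^1}\le C\|f\|_{H^1}$; (ii) the measure $d\mu_\omega(t)=\omega(t)\left(1+\int_0^t\frac{ds}{\widehat{\omega}(s)}\right)dt$ on the radius $[0,1)$, regarded as a Borel measure on $\mathbb{D}$, is a $1$-Carleson measure for $H^1$; that is, $H^1\subset L^1(\mu_\omega)$ and the identity map $H^1\to L^1(\mu_\omega)$ is bounded; (iii) $$\sup_{a\in[0,1)}\frac{1}{1-a}\int_a^1\omega(t)\left(1+\int_0^t\frac{ds}{\widehat{\omega}(s)}\right)dt<\infty.$$ -/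

import Mathlib

open MeasureTheory Set
open scoped ENNReal NNReal ComplexConjugate

noncomputable section

namespace HilbertType

/-- The open unit disc of the complex plane. -/
def disc : Set ℂ := Metric.ball 0 1

/-- The normalized area measure `dA = dx dy / π` on the unit disc. -/
def areaMeasure : Measure ℂ := ENNReal.ofReal (Real.pi⁻¹) • volume.restrict disc

/-- The tail integral `r ↦ ∫_r^1 ω(s) ds`. -/
def tail (ω : ℝ → ℝ) (r : ℝ) : ℝ := ∫ s in r..1, ω s

/-- `ω` is (the radial profile of) a radial weight: nonnegative and integrable on `[0,1)`, with
the standing assumption that its tail integrals do not vanish. Its extension to the disc is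
`z ↦ ω ‖z‖`. Values of `ω` outside `[0,1)` are irrelevant. -/
structure IsRadialWeight (ω : ℝ → ℝ) : Prop where
  nonneg : ∀ r ∈ Ico (0 : ℝ) 1, 0 ≤ ω r
  integrable : IntegrableOn ω (Ico 0 1) volume
  tail_pos : ∀ r ∈ Ico (0 : ℝ) 1, 0 < tail ω r

/-- The class of upper doubling radial weights. -/
structure IsUpperDoubling (ω : ℝ → ℝ) : Prop where
  radialWeight : IsRadialWeight ω
  doubling : ∃ C : ℝ, 1 ≤ C ∧ ∀ r ∈ Ico (0 : ℝ) 1, tail ω r ≤ C * tail ω ((1 + r) / 2)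

/-- Membership in the weighted Bergman space `A²_ω`. -/
structure MemBergman2 (ω : ℝ → ℝ) (f : ℂ → ℂ) : Prop where
  analytic : DifferentiableOn ℂ f disc
  integrable : Integrable (fun ζ : ℂ => ‖f ζ‖ ^ 2 * ω ‖ζ‖) areaMeasure

/-- `g` is the reproducing kernel of `A²_ω` at the point `z`: it lies in `A²_ω` and
`f(z) = ⟨f, g⟩` in `A²_ω` for every `f ∈ A²_ω`. Such a `g` is unique as a function on the disc. -/
def IsReproducingKernelAt (ω : ℝ → ℝ) (z : ℂ) (g : ℂ → ℂ) : Prop :=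
  MemBergman2 ω g ∧
    ∀ f : ℂ → ℂ, MemBergman2 ω f →
      f z = ∫ ζ, f ζ * conj (g ζ) * (ω ‖ζ‖ : ℂ) ∂areaMeasure

open Classical in
/-- The Bergman reproducing kernel `B^ω_z` of `A²_ω`, as a function on the disc. (For a radial
weight and `z` in the disc it exists, and its values on the disc are determined.) -/
def bergmanKernel (ω : ℝ → ℝ) (z : ℂ) : ℂ → ℂ :=
  if h : ∃ g : ℂ → ℂ, IsReproducingKernelAt ω z g then h.choose else 0

/-- The averaged kernel `K^ω_t(z) = (1/z) ∫_0^z B^ω_t(u) du`; the integral is along the segment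
`u = s z`, `0 ≤ s ≤ 1`, and the removable singularity at `z = 0` is filled with `B^ω_t(0)`. -/
def averagedKernel (ω : ℝ → ℝ) (t : ℝ) (z : ℂ) : ℂ :=
  if z = 0 then bergmanKernel ω (t : ℂ) 0
  else (1 / z) * ∫ s in (0 : ℝ)..1, bergmanKernel ω (t : ℂ) ((s : ℂ) * z) * z

/-- The integrand, in `t ∈ [0,1)`, of the Hilbert-type operator. -/
def hilbertIntegrand (ω : ℝ → ℝ) (f : ℂ → ℂ) (z : ℂ) (t : ℝ) : ℂ :=
  f (t : ℂ) * averagedKernel ω t z * (ω t : ℂ)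

/-- The Hilbert-type operator `H_ω(f)(z) = ∫_0^1 f(t) K^ω_t(z) ω(t) dt`. -/
def hilbertOp (ω : ℝ → ℝ) (f : ℂ → ℂ) (z : ℂ) : ℂ :=
  ∫ t in Ico (0 : ℝ) 1, hilbertIntegrand ω f z t

/-- The `H¹` norm `sup_{0<r<1} (1/2π) ∫_0^{2π} |f(r e^{iθ})| dθ`, with values in `[0,∞]`. -/
def hardyNorm (f : ℂ → ℂ) : ℝ≥0∞ :=
  ⨆ r ∈ Ioo (0 : ℝ) 1, ENNReal.ofReal (Real.circleAverage (fun z : ℂ => ‖f z‖) 0 r)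

/-- Membership in the Hardy space `H¹` of the disc. -/
structure MemHardy (f : ℂ → ℂ) : Prop where
  analytic : DifferentiableOn ℂ f disc
  norm_lt_top : hardyNorm f < ∞

/-- `H_ω : H¹ → H¹` is bounded: for `f ∈ H¹` the integral defining `H_ω(f)(z)` converges absolutely
at every `z` of the disc, `H_ω(f)` belongs to `H¹`, and its norm is at most a constant times that
of `f`. -/
def HilbertBoundedOnHardy (ω : ℝ → ℝ) : Prop :=
  ∃ C : ℝ≥0, ∀ f : ℂ → ℂ, MemHardy f →
    (∀ z ∈ disc, IntegrableOn (hilbertIntegrand ω f z) (Ico 0 1) volume) ∧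
    MemHardy (hilbertOp ω f) ∧
    hardyNorm (hilbertOp ω f) ≤ C * hardyNorm f

/-- `μ` is a `q`-Carleson measure for `H¹`: the identity `H¹ → L^q(μ)` is defined and bounded. -/
def IsCarlesonForHardy (q : ℝ≥0∞) (μ : Measure ℂ) : Prop :=
  ∃ C : ℝ≥0, ∀ f : ℂ → ℂ, MemHardy f →
    MemLp f q μ ∧ eLpNorm f q μ ≤ C * hardyNorm f

/-- The density `ω(t) (1 + ∫_0^t ds / ω̂(s))`, where `ω̂` is the tail integral of `ω`. -/
def carlesonDensity (ω : ℝ → ℝ) (t : ℝ) : ℝ :=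
  ω t * (1 + ∫ s in (0 : ℝ)..t, 1 / tail ω s)

/-- The measure `ω(t) (1 + ∫_0^t ds / ω̂(s)) dt` on the radius `[0,1)`, viewed as a Borel measure
on the disc. -/
def radialMeasure (ω : ℝ → ℝ) : Measure ℂ :=
  Measure.map (fun t : ℝ => (t : ℂ))
    ((volume.restrict (Ico (0 : ℝ) 1)).withDensity
      (fun t => ENNReal.ofReal (carlesonDensity ω t)))

end HilbertType

end

/-!
Expanding `B^ω_t` in monomials gives `K^ω_t(z) = k(t z)`, where the Taylor coefficients of `k` are
nonnegative and comparable to `1 / ((n + 1) ω_n)`, with `ω_n` the moments of `ω`; for `ω` in the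
doubling class moments are comparable to tail integrals. All three conditions are equivalent to the
Carleson condition `μ_ω([a,1)) ≤ A (1 - a)` on the radius.

It is necessary for the embedding of `H¹`, by testing on `(1 - a) / (1 - a z)²`. It is sufficient
because `∫ |h|² dν ≤ 8 A ‖h‖²_{H²}` (Hilbert's inequality), and because the zeros of a polynomial
can be reflected out of the disc, which makes it the square of an analytic function.

If the Carleson condition holds, then the kernels have `H¹` norm at most a constant times
`1 + ∫_0^t ds / ω̂(s)`, so Minkowski's inequality and the embedding bound `H_ω`. Conversely, the
Fejér–Riesz inequality bounds `∫_0^1 |H_ω(f)(x)| dx` by a constant times `‖f‖_{H¹}`, while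
`k(t x) ≥ c / ω̂(t x)` and `∫_0^1 dx / ω̂(t x) ≥ c (1 + ∫_0^t ds / ω̂(s))`; for the test functions,
which are positive on the radius, this gives their embedding into `L¹(μ_ω)`.
-/

noncomputable section

namespace HilbertType

open Real (circleAverage)
open Filter Topology

/-! ### Power series on circles and on the disc -/

lemma mem_disc {z : ℂ} : z ∈ disc ↔ ‖z‖ < 1 := mem_ball_zero_iff

lemma isOpen_disc : IsOpen disc := Metric.isOpen_ball

lemma ofReal_mem_disc {t : ℝ} (ht : t ∈ Ico (0 : ℝ) 1) : (t : ℂ) ∈ disc := by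
  simp [mem_disc, abs_of_nonneg ht.1, ht.2]

lemma mul_mem_disc {w z : ℂ} (hw : ‖w‖ ≤ 1) (hz : z ∈ disc) : w * z ∈ disc := by
  rw [mem_disc, norm_mul]
  exact (mul_le_of_le_one_left (norm_nonneg z) hw).trans_lt (mem_disc.1 hz)

lemma continuousOn_comp_ofReal {f : ℂ → ℂ} (hf : DifferentiableOn ℂ f disc) :
    ContinuousOn (fun t : ℝ => f t) (Ico 0 1) :=
  hf.continuousOn.comp Complex.continuous_ofReal.continuousOn fun _ => ofReal_mem_disc

/-- `F` is the sum of the power series `∑ aₙ zⁿ` on the circle of radius `ρ`, where the series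
converges absolutely. Termwise integration over a single circle needs no more than this. -/
structure HasPowerSeriesOnCircle (a : ℕ → ℂ) (ρ : ℝ) (F : ℂ → ℂ) : Prop where
  radius_nonneg : 0 ≤ ρ
  summable : Summable fun n => ‖a n‖ * ρ ^ n
  hasSum : ∀ z, ‖z‖ = ρ → HasSum (fun n => a n * z ^ n) (F z)

/-- `f` is the sum of the power series `∑ aₙ zⁿ` on the unit disc: `HasFPowerSeriesOnBall` at the
centre `0`, stated for scalar coefficients. -/
def HasPowerSeriesOnDisc (a : ℕ → ℂ) (f : ℂ → ℂ) : Prop :=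
  ∀ z ∈ disc, HasSum (fun n => a n * z ^ n) (f z)

namespace HasPowerSeriesOnCircle

variable {a : ℕ → ℂ} {ρ : ℝ} {F : ℂ → ℂ}

lemma continuousOn (H : HasPowerSeriesOnCircle a ρ F) : ContinuousOn F (Metric.sphere 0 ρ) := by
  have h : ContinuousOn (fun z => ∑' n, a n * z ^ n) (Metric.sphere (0 : ℂ) ρ) := by
    refine continuousOn_tsum (fun n => by fun_prop) H.summable fun n z hz => ?_
    rw [norm_mul, norm_pow, mem_sphere_zero_iff_norm.1 hz]
  exact h.congr fun z hz => ((H.hasSum z (mem_sphere_zero_iff_norm.1 hz)).tsum_eq).symm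

lemma hasSum_circleAverage_mul (H : HasPowerSeriesOnCircle a ρ F) {g : ℂ → ℂ}
    (hg : ContinuousOn g (Metric.sphere 0 ρ)) :
    HasSum (fun n => a n * circleAverage (fun z => z ^ n * g z) 0 ρ)
      (circleAverage (fun z => F z * g z) 0 ρ) := by
  obtain ⟨M, hM⟩ := (isCompact_sphere (0 : ℂ) ρ).exists_bound_of_continuousOn hg
  have hmem (θ : ℝ) : circleMap 0 ρ θ ∈ Metric.sphere (0 : ℂ) ρ :=
    circleMap_mem_sphere 0 H.radius_nonneg θ
  have hnorm (θ : ℝ) : ‖circleMap 0 ρ θ‖ = ρ := mem_sphere_zero_iff_norm.1 (hmem θ)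
  have hgc : Continuous fun θ => g (circleMap 0 ρ θ) :=
    hg.comp_continuous (continuous_circleMap 0 ρ) hmem
  have hint : HasSum
      (fun n => ∫ θ in (0 : ℝ)..2 * Real.pi, a n * (circleMap 0 ρ θ ^ n * g (circleMap 0 ρ θ)))
      (∫ θ in (0 : ℝ)..2 * Real.pi, F (circleMap 0 ρ θ) * g (circleMap 0 ρ θ)) := by
    refine intervalIntegral.hasSum_integral_of_dominated_convergence
      (fun n _ => ‖a n‖ * ρ ^ n * M) (fun n => ?_) (fun n => .of_forall fun θ _ => ?_)
      (.of_forall fun θ _ => H.summable.mul_right M) intervalIntegrable_const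
      (.of_forall fun θ _ => ?_)
    · exact (continuous_const.mul (((continuous_circleMap 0 ρ).pow n).mul hgc)).aestronglyMeasurable
    · rw [norm_mul, norm_mul, norm_pow, hnorm, mul_assoc]
      gcongr
      exacts [pow_nonneg H.radius_nonneg n, hM _ (hmem θ)]
    · simpa only [mul_assoc] using (H.hasSum _ (hnorm θ)).mul_right (g (circleMap 0 ρ θ))
  simpa only [Real.circleAverage_def, mul_smul_comm, intervalIntegral.integral_const_mul]
    using hint.const_smul ((2 * Real.pi)⁻¹ : ℝ)

end HasPowerSeriesOnCircle

lemma circleAverage_pow_mul_conj_pow (m n : ℕ) (ρ : ℝ) :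
    circleAverage (fun z : ℂ => z ^ m * conj z ^ n) 0 ρ =
      if m = n then (ρ : ℂ) ^ (2 * n) else 0 := by
  have h (θ : ℝ) : circleMap 0 ρ θ ^ m * conj (circleMap 0 ρ θ) ^ n
      = (ρ : ℂ) ^ (m + n) * Complex.exp ((((m : ℤ) - n : ℤ) * Complex.I) * θ) := by
    simp only [circleMap, zero_add, map_mul, Complex.conj_ofReal, ← Complex.exp_conj,
      Complex.conj_I, mul_pow, ← Complex.exp_nat_mul]
    rw [mul_mul_mul_comm, ← pow_add, ← Complex.exp_add]
    congr 2
    push_cast; ring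
  simp_rw [Real.circleAverage_def, h, intervalIntegral.integral_const_mul]
  split_ifs with hmn
  · subst hmn
    simp [← two_mul]
    field_simp
  · have hne : (((m : ℤ) - n : ℤ) : ℂ) ≠ 0 := by
      rw [Int.cast_ne_zero]; lia
    have hperiod : Complex.exp ((((m : ℤ) - n : ℤ) * Complex.I) * ((2 * Real.pi : ℝ) : ℂ)) = 1 := by
      rw [← Complex.exp_int_mul_two_pi_mul_I ((m : ℤ) - n)]
      congr 1; push_cast; ring
    rw [integral_exp_mul_complex (mul_ne_zero hne Complex.I_ne_zero), hperiod]
    simp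

namespace HasPowerSeriesOnCircle

variable {a : ℕ → ℂ} {ρ : ℝ} {F : ℂ → ℂ}

lemma circleAverage_mul_conj_pow (H : HasPowerSeriesOnCircle a ρ F) (n : ℕ) :
    circleAverage (fun z => F z * conj z ^ n) 0 ρ = a n * (ρ : ℂ) ^ (2 * n) := by
  refine (H.hasSum_circleAverage_mul (g := fun z => conj z ^ n) (by fun_prop)).unique ?_
  simp_rw [circleAverage_pow_mul_conj_pow]
  convert hasSum_ite_eq n (a n * (ρ : ℂ) ^ (2 * n)) using 2 with m
  split_ifs with h <;> simp [h]

lemma hasSum_circleAverage_norm_sq (H : HasPowerSeriesOnCircle a ρ F) :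
    HasSum (fun n => ‖a n‖ ^ 2 * ρ ^ (2 * n)) (circleAverage (fun z => ‖F z‖ ^ 2) 0 ρ) := by
  have hcoeff (n : ℕ) : circleAverage (fun z => z ^ n * conj (F z)) 0 ρ
      = conj (a n) * (ρ : ℂ) ^ (2 * n) := by
    have hc : CircleIntegrable (fun z => F z * conj z ^ n) 0 ρ :=
      (H.continuousOn.mul (by fun_prop)).circleIntegrable H.radius_nonneg
    have h := Complex.conjCLE.toContinuousLinearMap.circleAverage_comp_comm hc
    rw [H.circleAverage_mul_conj_pow n] at h
    simpa [Function.comp_def, mul_comm] using h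
  have hnorm : circleAverage (fun z => F z * conj (F z)) 0 ρ
      = ((circleAverage (fun z => ‖F z‖ ^ 2) 0 ρ : ℝ) : ℂ) := by
    have hc : CircleIntegrable (fun z => ‖F z‖ ^ 2) 0 ρ :=
      (H.continuousOn.norm.pow 2).circleIntegrable H.radius_nonneg
    simpa [Function.comp_def, Complex.mul_conj'] using
      Complex.ofRealCLM.circleAverage_comp_comm hc
  have h := H.hasSum_circleAverage_mul (Complex.continuous_conj.comp_continuousOn H.continuousOn)
  simp only [Function.comp_apply, hcoeff, hnorm] at h
  rw [← Complex.hasSum_ofReal]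
  convert h using 2 with n
  rw [← mul_assoc, Complex.mul_conj']
  push_cast; ring

end HasPowerSeriesOnCircle

lemma exists_hasPowerSeriesOnDisc {f : ℂ → ℂ} (hf : DifferentiableOn ℂ f disc) :
    ∃ a : ℕ → ℂ, HasPowerSeriesOnDisc a f := by
  refine ⟨fun n => (n.factorial : ℂ)⁻¹ * iteratedDeriv n f 0, fun z hz => ?_⟩
  simpa [mul_assoc, mul_comm, mul_left_comm] using
    Complex.hasSum_taylorSeries_on_ball (c := 0) (r := 1) (f := f) hf hz

lemma hasPowerSeriesOnDisc_tsum {a : ℕ → ℂ}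
    (ha : ∀ ρ ∈ Ico (0 : ℝ) 1, Summable fun n => ‖a n‖ * ρ ^ n) :
    HasPowerSeriesOnDisc a fun z => ∑' n, a n * z ^ n := fun z hz =>
  (Summable.of_norm (by simpa using ha ‖z‖ ⟨norm_nonneg z, mem_disc.1 hz⟩)).hasSum

namespace HasPowerSeriesOnDisc

variable {a : ℕ → ℂ} {f : ℂ → ℂ} {ρ : ℝ}

lemma summable_norm (H : HasPowerSeriesOnDisc a f) (hρ : ρ ∈ Ico (0 : ℝ) 1) :
    Summable fun n => ‖a n‖ * ρ ^ n := by
  simpa [abs_of_nonneg hρ.1] using (H ρ (ofReal_mem_disc hρ)).summable.norm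

lemma onCircle (H : HasPowerSeriesOnDisc a f) (hρ : ρ ∈ Ico (0 : ℝ) 1) :
    HasPowerSeriesOnCircle a ρ f :=
  ⟨hρ.1, H.summable_norm hρ, fun z hz => H z (mem_disc.2 (hz ▸ hρ.2))⟩

lemma differentiableOn (H : HasPowerSeriesOnDisc a f) : DifferentiableOn ℂ f disc := by
  suffices h : DifferentiableOn ℂ (fun z => ∑' n, a n * z ^ n) disc from
    h.congr fun z hz => (H z hz).tsum_eq.symm
  intro z hz
  obtain ⟨ρ, hzρ, hρ1⟩ := exists_between (mem_disc.1 hz)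
  have hρ : ρ ∈ Ico (0 : ℝ) 1 := ⟨(norm_nonneg z).trans hzρ.le, hρ1⟩
  have h := Complex.differentiableOn_tsum_of_summable_norm (H.summable_norm hρ)
    (F := fun n z => a n * z ^ n) (U := Metric.ball 0 ρ) (fun n => by fun_prop) Metric.isOpen_ball
    fun n w hw => by
      rw [norm_mul, norm_pow]
      gcongr
      exact (mem_ball_zero_iff.1 hw).le
  exact (h.differentiableAt
    (Metric.isOpen_ball.mem_nhds (mem_ball_zero_iff.2 hzρ))).differentiableWithinAt

end HasPowerSeriesOnDisc

/-! ### Integral means -/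

lemma circleAverage_comp_mul (f : ℂ → ℝ) (c ρ : ℝ) :
    circleAverage (fun z => f (c * z)) 0 ρ = circleAverage f 0 (c * ρ) := by
  simp only [Real.circleAverage_def, circleMap, zero_add, Complex.ofReal_mul, mul_assoc]

lemma circleAverage_norm_mul_le {F G : ℂ → ℂ} {ρ W : ℝ} (hρ : 0 ≤ ρ)
    (hF : ContinuousOn F (Metric.sphere 0 ρ)) (hG : ContinuousOn G (Metric.sphere 0 ρ))
    (hW : 0 < W) :
    circleAverage (fun z => ‖F z * G z‖) 0 ρ ≤
      1 / (2 * W) * circleAverage (fun z => ‖F z‖ ^ 2) 0 ρ +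
        W / 2 * circleAverage (fun z => ‖G z‖ ^ 2) 0 ρ := by
  have hF' : CircleIntegrable (fun z => (1 / (2 * W)) • ‖F z‖ ^ 2) 0 ρ :=
    (continuousOn_const.fun_smul (hF.norm.pow 2)).circleIntegrable hρ
  have hG' : CircleIntegrable (fun z => (W / 2) • ‖G z‖ ^ 2) 0 ρ :=
    (continuousOn_const.fun_smul (hG.norm.pow 2)).circleIntegrable hρ
  simp only [← smul_eq_mul (1 / (2 * W)), ← smul_eq_mul (W / 2), ← Real.circleAverage_fun_smul]
  rw [← Real.circleAverage_fun_add hF' hG']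
  refine Real.circleAverage_mono ((hF.mul hG).norm.circleIntegrable hρ) (hF'.add hG') fun z _ => ?_
  have hsq : 1 / (2 * W) * ‖F z‖ ^ 2 + W / 2 * ‖G z‖ ^ 2 - ‖F z * G z‖ =
      (‖F z‖ - W * ‖G z‖) ^ 2 / (2 * W) := by
    rw [norm_mul]
    field_simp
    ring
  rw [← sub_nonneg]
  exact hsq ▸ by positivity

lemma ofReal_circleAverage_norm {F : ℂ → ℂ} {ρ : ℝ} (hρ : 0 ≤ ρ)
    (hF : ContinuousOn F (Metric.sphere 0 ρ)) :
    ENNReal.ofReal (circleAverage (fun z => ‖F z‖) 0 ρ) =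
      ENNReal.ofReal (2 * Real.pi)⁻¹ * ∫⁻ θ in Ioc 0 (2 * Real.pi), ‖F (circleMap 0 ρ θ)‖ₑ := by
  have hc : Continuous fun θ => F (circleMap 0 ρ θ) :=
    hF.comp_continuous (continuous_circleMap 0 ρ) (circleMap_mem_sphere 0 hρ)
  rw [Real.circleAverage_def, smul_eq_mul, ENNReal.ofReal_mul (by positivity),
    intervalIntegral.integral_of_le (by positivity),
    ofReal_integral_eq_lintegral_ofReal hc.norm.integrableOn_Ioc
      (.of_forall fun θ => norm_nonneg _)]
  simp_rw [ofReal_norm]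

lemma ofReal_circleAverage_norm_integral_le {μ : Measure ℝ} [SFinite μ] {Φ : ℝ → ℂ → ℂ}
    {F : ℂ → ℂ} {ρ : ℝ} (hρ : 0 ≤ ρ) (hF : ContinuousOn F (Metric.sphere 0 ρ))
    (hΦ : ∀ᵐ s ∂μ, ContinuousOn (Φ s) (Metric.sphere 0 ρ))
    (hmeas : AEStronglyMeasurable (fun p : ℝ × ℝ => Φ p.1 (circleMap 0 ρ p.2))
      (μ.prod (volume.restrict (Ioc 0 (2 * Real.pi)))))
    (hFΦ : ∀ z, ‖z‖ = ρ → F z = ∫ s, Φ s z ∂μ) :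
    ENNReal.ofReal (circleAverage (fun z => ‖F z‖) 0 ρ) ≤
      ∫⁻ s, ENNReal.ofReal (circleAverage (fun z => ‖Φ s z‖) 0 ρ) ∂μ := by
  set c := ENNReal.ofReal (2 * Real.pi)⁻¹
  calc ENNReal.ofReal (circleAverage (fun z => ‖F z‖) 0 ρ)
    _ = c * ∫⁻ θ in Ioc 0 (2 * Real.pi), ‖F (circleMap 0 ρ θ)‖ₑ := ofReal_circleAverage_norm hρ hF
    _ ≤ c * ∫⁻ θ in Ioc 0 (2 * Real.pi), ∫⁻ s, ‖Φ s (circleMap 0 ρ θ)‖ₑ ∂μ := by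
      gcongr with θ
      rw [hFΦ _ (mem_sphere_zero_iff_norm.1 (circleMap_mem_sphere 0 hρ θ))]
      exact enorm_integral_le_lintegral_enorm _
    _ = c * ∫⁻ s, ∫⁻ θ in Ioc 0 (2 * Real.pi), ‖Φ s (circleMap 0 ρ θ)‖ₑ ∂volume ∂μ := by
      rw [lintegral_lintegral_swap (f := fun s θ => ‖Φ s (circleMap 0 ρ θ)‖ₑ) hmeas.enorm]
    _ = ∫⁻ s, c * ∫⁻ θ in Ioc 0 (2 * Real.pi), ‖Φ s (circleMap 0 ρ θ)‖ₑ ∂volume ∂μ :=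
      (lintegral_const_mul' _ _ ENNReal.ofReal_ne_top).symm
    _ = ∫⁻ s, ENNReal.ofReal (circleAverage (fun z => ‖Φ s z‖) 0 ρ) ∂μ :=
      lintegral_congr_ae <| hΦ.mono fun s hs => (ofReal_circleAverage_norm hρ hs).symm

lemma HasPowerSeriesOnCircle.circleAverage_norm_sq_le {a : ℕ → ℂ} {ρ : ℝ} {F : ℂ → ℂ}
    (H : HasPowerSeriesOnCircle a ρ F) {M q : ℝ} (hq : q ∈ Ico (0 : ℝ) 1)
    (ha : ∀ n, ‖a n‖ * ρ ^ n ≤ M * q ^ n) :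
    circleAverage (fun z => ‖F z‖ ^ 2) 0 ρ ≤ M ^ 2 / (1 - q) := by
  have hρ := H.radius_nonneg
  rw [div_eq_mul_inv]
  refine hasSum_le (fun n => ?_) H.hasSum_circleAverage_norm_sq
    ((hasSum_geometric_of_lt_one hq.1 hq.2).mul_left (M ^ 2))
  calc ‖a n‖ ^ 2 * ρ ^ (2 * n) = (‖a n‖ * ρ ^ n) ^ 2 := by ring
    _ ≤ (M * q ^ n) ^ 2 := pow_le_pow_left₀ (by positivity) (ha n) 2
    _ = M ^ 2 * q ^ (2 * n) := by ring
    _ ≤ M ^ 2 * q ^ n := by gcongr ?_ * ?_; exact pow_le_pow_of_le_one hq.1 hq.2.le (by lia)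

lemma hasPowerSeriesOnDisc_inv_one_sub_mul {c : ℂ} (hc : ‖c‖ ≤ 1) :
    HasPowerSeriesOnDisc (fun n => c ^ n) fun z => (1 - c * z)⁻¹ := fun z hz => by
  simpa only [mul_pow] using hasSum_geometric_of_norm_lt_one (mem_disc.1 (mul_mem_disc hc hz))

lemma circleAverage_norm_inv_one_sub_mul_sq_le {c : ℂ} (hc : ‖c‖ ≤ 1) {ρ : ℝ}
    (hρ : ρ ∈ Ico (0 : ℝ) 1) :
    circleAverage (fun z => ‖(1 - c * z)⁻¹‖ ^ 2) 0 ρ ≤ 1 / (1 - ‖c‖ * ρ) := by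
  have hq : ‖c‖ * ρ ∈ Ico (0 : ℝ) 1 :=
    ⟨mul_nonneg (norm_nonneg c) hρ.1, (mul_le_of_le_one_left hρ.1 hc).trans_lt hρ.2⟩
  simpa using ((hasPowerSeriesOnDisc_inv_one_sub_mul hc).onCircle hρ).circleAverage_norm_sq_le
    (M := 1) hq fun n => by rw [norm_pow, one_mul, mul_pow]

lemma norm_ofReal_le_one {s : ℝ} (hs : s ∈ Icc (0 : ℝ) 1) : ‖(s : ℂ)‖ ≤ 1 := by
  rw [Complex.norm_of_nonneg hs.1]
  exact hs.2

lemma HasPowerSeriesOnDisc.hasSum_integral {a : ℕ → ℂ} {f : ℂ → ℂ} (H : HasPowerSeriesOnDisc a f)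
    {w : ℂ} (hw : w ∈ disc) :
    HasSum (fun n => a n / (n + 1) * w ^ n) (∫ s in (0 : ℝ)..1, f (s * w)) := by
  have hnorm {s : ℝ} (hs : s ∈ uIoc 0 1) : ‖(s : ℂ)‖ ≤ 1 :=
    norm_ofReal_le_one (Ioc_subset_Icc_self (uIoc_of_le (zero_le_one (α := ℝ)) ▸ hs))
  have hterm (n : ℕ) : ∫ s in (0 : ℝ)..1, a n * (s * w) ^ n = a n / (n + 1) * w ^ n := by
    have hpow (s : ℝ) : a n * (s * w) ^ n = a n * w ^ n * ((s ^ n : ℝ) : ℂ) := by push_cast; ring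
    simp_rw [hpow, intervalIntegral.integral_const_mul, intervalIntegral.integral_ofReal,
      integral_pow]
    push_cast
    simp only [one_pow, zero_pow n.succ_ne_zero]
    ring
  simp only [← hterm]
  refine intervalIntegral.hasSum_integral_of_dominated_convergence
    (fun n _ => ‖a n‖ * ‖w‖ ^ n)
    (fun n => (by fun_prop : Continuous _).aestronglyMeasurable)
    (fun n => .of_forall fun s hs => ?_)
    (.of_forall fun _ _ => H.summable_norm ⟨norm_nonneg w, mem_disc.1 hw⟩)
    intervalIntegrable_const (.of_forall fun s hs => H _ (mul_mem_disc (hnorm hs) hw))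
  rw [norm_mul, norm_pow, norm_mul]
  gcongr
  exact mul_le_of_le_one_left (norm_nonneg w) (hnorm hs)

/-! ### The radial Carleson embedding theorem for `H¹` -/

lemma lintegral_enorm_le_of_tendsto {α E : Type*} [MeasurableSpace α] {μ : Measure α}
    [NormedAddCommGroup E] {F : ℕ → α → E} {f : α → E} {B : ℕ → ℝ≥0∞} {b : ℝ≥0∞}
    (hF : ∀ N, AEStronglyMeasurable (F N) μ)
    (hlim : ∀ᵐ t ∂μ, Tendsto (fun N => F N t) atTop (𝓝 (f t)))
    (hB : ∀ N, ∫⁻ t, ‖F N t‖ₑ ∂μ ≤ B N) (hb : Tendsto B atTop (𝓝 b)) :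
    ∫⁻ t, ‖f t‖ₑ ∂μ ≤ b := by
  calc ∫⁻ t, ‖f t‖ₑ ∂μ = ∫⁻ t, liminf (fun N => ‖F N t‖ₑ) atTop ∂μ := by
        refine lintegral_congr_ae ?_
        filter_upwards [hlim] with t ht using ht.enorm.liminf_eq.symm
    _ ≤ liminf (fun N => ∫⁻ t, ‖F N t‖ₑ ∂μ) atTop := lintegral_liminf_le' fun N => (hF N).enorm
    _ ≤ liminf B atTop := liminf_le_liminf (.of_forall hB)
    _ = b := hb.liminf_eq

/-- The Carleson condition `ν([a,1)) ≤ A (1 - a)`, for the part on the radius `[0,1)` of a measure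
`ν` on the line. -/
def IsRadialCarleson (ν : Measure ℝ) (A : ℝ≥0) : Prop :=
  ∀ a ∈ Ico (0 : ℝ) 1, ν (Ico a 1) ≤ A * ENNReal.ofReal (1 - a)

lemma IsRadialCarleson.superlevel_le {ν : Measure ℝ} {A : ℝ≥0} (hν : IsRadialCarleson ν A) {s : ℝ}
    (hs : 0 < s) :
    ν.restrict (Ico 0 1) {t | s ≤ t} ≤ A * volume.restrict (Ico (0 : ℝ) 1) {t | s ≤ t} := by
  have hset : {t | s ≤ t} ∩ Ico (0 : ℝ) 1 = Ico s 1 := by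
    ext t; simp only [mem_inter_iff, mem_ofPred_eq, mem_Ico]; grind
  have hmeas : MeasurableSet {t : ℝ | s ≤ t} := measurableSet_Ici
  rw [Measure.restrict_apply hmeas, Measure.restrict_apply hmeas, hset, Real.volume_Ico]
  rcases lt_or_ge s 1 with hs1 | hs1
  · exact hν s ⟨hs.le, hs1⟩
  · simp [Ico_eq_empty_of_le hs1]

lemma setLIntegral_Ico_pow (k : ℕ) :
    ∫⁻ t in Ico (0 : ℝ) 1, ENNReal.ofReal (t ^ k) = ENNReal.ofReal (1 / (k + 1)) := by
  have hint : IntegrableOn (fun t : ℝ => t ^ k) (Ico 0 1) :=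
    (continuous_pow k).integrableOn_Icc.mono_set Ico_subset_Icc_self
  rw [← ofReal_integral_eq_lintegral_ofReal hint
    (ae_restrict_of_forall_mem measurableSet_Ico fun t ht => pow_nonneg ht.1 k),
    integral_Ico_eq_integral_Ioc, ← intervalIntegral.integral_of_le zero_le_one, integral_pow]
  simp

lemma IsRadialCarleson.setLIntegral_pow_le {ν : Measure ℝ} {A : ℝ≥0} (hν : IsRadialCarleson ν A)
    (k : ℕ) :
    ∫⁻ t in Ico (0 : ℝ) 1, ENNReal.ofReal (t ^ k) ∂ν ≤ A * ENNReal.ofReal (1 / (k + 1)) := by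
  rcases k.eq_zero_or_pos with rfl | hk
  · simpa using hν 0 (by simp)
  have layercake (κ : Measure ℝ) : ∫⁻ t in Ico (0 : ℝ) 1, ENNReal.ofReal (t ^ k) ∂κ =
      ENNReal.ofReal k * ∫⁻ s in Ioi 0, κ.restrict (Ico 0 1) {t | s ≤ t} *
        ENNReal.ofReal (s ^ ((k : ℝ) - 1)) := by
    simpa only [Real.rpow_natCast] using lintegral_rpow_eq_lintegral_meas_le_mul
      (κ.restrict (Ico 0 1)) (ae_restrict_of_forall_mem measurableSet_Ico fun t ht => ht.1)
      aemeasurable_id' (p := k) (by exact_mod_cast hk)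
  rw [← setLIntegral_Ico_pow, layercake, layercake, mul_left_comm,
    ← lintegral_const_mul' _ _ ENNReal.coe_ne_top]
  gcongr _ * ?_
  refine setLIntegral_mono' measurableSet_Ioi fun s hs => ?_
  rw [← mul_assoc]
  gcongr
  exact hν.superlevel_le hs

lemma sum_sum_mul_le_of_schur {ι : Type*} {s : Finset ι} {K : ι → ι → ℝ} {w : ι → ℝ} {C : ℝ}
    (hsymm : ∀ i j, K i j = K j i) (hK : ∀ i j, 0 ≤ K i j) (hw : ∀ i, 0 < w i)
    (hC : ∀ i, ∑ j ∈ s, K i j * w j ≤ C * w i) (x : ι → ℝ) :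
    ∑ i ∈ s, ∑ j ∈ s, x i * x j * K i j ≤ C * ∑ i ∈ s, x i ^ 2 := by
  set T : ι → ι → ℝ := fun i j => x i ^ 2 / w i * (K i j * w j) with hT
  have am_gm (i j : ι) : x i * x j * K i j ≤ (T i j + T j i) / 2 := by
    have h : (T i j + T j i) / 2 - x i * x j * K i j
        = K i j * (x i * w j - x j * w i) ^ 2 / (2 * w i * w j) := by
      have := (hw i).ne'
      have := (hw j).ne'
      simp only [hT, hsymm j i]
      field_simp
      ring
    have := hK i j
    have := hw i
    have := hw j
    rw [← sub_nonneg, h]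
    positivity
  calc ∑ i ∈ s, ∑ j ∈ s, x i * x j * K i j
      ≤ ∑ i ∈ s, ∑ j ∈ s, (T i j + T j i) / 2 :=
        Finset.sum_le_sum fun i _ => Finset.sum_le_sum fun j _ => am_gm i j
    _ = ∑ i ∈ s, ∑ j ∈ s, T i j := by
        simp only [← Finset.sum_div, Finset.sum_add_distrib]
        rw [Finset.sum_comm (f := fun i j => T j i), add_self_div_two]
    _ ≤ ∑ i ∈ s, C * x i ^ 2 := by
        refine Finset.sum_le_sum fun i _ => ?_
        rw [← Finset.mul_sum]
        have := hw i
        calc x i ^ 2 / w i * ∑ j ∈ s, K i j * w j ≤ x i ^ 2 / w i * (C * w i) := by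
              gcongr; exact hC i
          _ = C * x i ^ 2 := by field_simp
    _ = C * ∑ i ∈ s, x i ^ 2 := (Finset.mul_sum ..).symm

lemma one_div_mul_sqrt_le_sub {c : ℝ} (hc : 1 ≤ c) (m : ℕ) :
    1 / ((c ^ 2 + m) * √(m + 1)) ≤
      8 / c * (√(m + 1) / (√(m + 1) + c)) - 8 / c * (√m / (√m + c)) := by
  have : 0 < c := by linarith
  have hp : 0 ≤ √(m : ℝ) := Real.sqrt_nonneg _
  have hq : 0 < √((m : ℝ) + 1) := by positivity
  have hp2 : √(m : ℝ) ^ 2 = m := Real.sq_sqrt (by positivity)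
  have hq2 : √((m : ℝ) + 1) ^ 2 = m + 1 := Real.sq_sqrt (by positivity)
  have hpq : √(m : ℝ) ≤ √((m : ℝ) + 1) := Real.sqrt_le_sqrt (by linarith)
  set p := √(m : ℝ)
  set q := √((m : ℝ) + 1)
  have hsub : 8 / c * (q / (q + c)) - 8 / c * (p / (p + c)) =
      8 / ((q + p) * (q + c) * (p + c)) := by
    have hdiff : q - p = 1 / (q + p) := by
      rw [eq_div_iff (by positivity)]; linarith [mul_comm (q - p) (q + p), sq_sub_sq q p]
    calc 8 / c * (q / (q + c)) - 8 / c * (p / (p + c)) = 8 * (q - p) / ((q + c) * (p + c)) := by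
          field_simp; ring
      _ = 8 / ((q + p) * (q + c) * (p + c)) := by rw [hdiff]; field_simp
  rw [hsub, div_le_div_iff₀ (by positivity) (by positivity), one_mul]
  calc (q + p) * (q + c) * (p + c) ≤ (q + q) * (q + c) * (q + c) := by gcongr
    _ ≤ 8 * (((q ^ 2 + c ^ 2) / 2) * q) := by nlinarith [sq_nonneg (q - c)]
    _ ≤ 8 * ((c ^ 2 + m) * q) := by
        gcongr
        nlinarith

lemma sum_one_div_mul_sqrt_le (n N : ℕ) :
    ∑ m ∈ Finset.range N, 1 / (((n : ℝ) + m + 1) * √(m + 1)) ≤ 8 / √(n + 1) := by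
  have hc : 1 ≤ √((n : ℝ) + 1) := Real.one_le_sqrt.2 (by linarith [n.cast_nonneg (α := ℝ)])
  set c := √((n : ℝ) + 1)
  have hc2 : c ^ 2 = n + 1 := Real.sq_sqrt (by positivity)
  calc ∑ m ∈ Finset.range N, 1 / (((n : ℝ) + m + 1) * √(m + 1))
      ≤ ∑ m ∈ Finset.range N,
          (8 / c * (√(m + 1 : ℕ) / (√(m + 1 : ℕ) + c)) - 8 / c * (√m / (√m + c))) := by
        gcongr with m
        simpa [hc2, add_right_comm] using one_div_mul_sqrt_le_sub hc m
    _ = 8 / c * (√N / (√N + c)) := by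
        rw [Finset.sum_range_sub fun m : ℕ => 8 / c * (√m / (√m + c))]; simp
    _ ≤ 8 / c * 1 := by
        gcongr
        exact div_le_one_of_le₀ (by linarith) (by positivity)
    _ = 8 / c := mul_one _

lemma hilbert_inequality (x : ℕ → ℝ) (N : ℕ) :
    ∑ n ∈ Finset.range N, ∑ m ∈ Finset.range N, x n * x m * (1 / ((n + m : ℕ) + 1)) ≤
      8 * ∑ n ∈ Finset.range N, x n ^ 2 := by
  refine sum_sum_mul_le_of_schur (K := fun n m : ℕ => 1 / (((n + m : ℕ) : ℝ) + 1))
    (w := fun m => 1 / √((m : ℝ) + 1)) (fun n m => by rw [add_comm n m])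
    (fun n m => by positivity) (fun m => by positivity) (fun n => ?_) x
  simpa [mul_comm, div_eq_mul_inv] using sum_one_div_mul_sqrt_le n N

lemma hilbert_inequality_enorm (a : ℕ → ℂ) {N : ℕ} {M : ℝ}
    (hM : ∑ n ∈ Finset.range N, ‖a n‖ ^ 2 ≤ M) :
    ∑ n ∈ Finset.range N, ∑ m ∈ Finset.range N,
        ‖a n‖ₑ * ‖a m‖ₑ * ENNReal.ofReal (1 / ((n + m : ℕ) + 1)) ≤ 8 * ENNReal.ofReal M := by
  calc ∑ n ∈ Finset.range N, ∑ m ∈ Finset.range N,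
        ‖a n‖ₑ * ‖a m‖ₑ * ENNReal.ofReal (1 / ((n + m : ℕ) + 1))
      = ENNReal.ofReal (∑ n ∈ Finset.range N, ∑ m ∈ Finset.range N,
          ‖a n‖ * ‖a m‖ * (1 / ((n + m : ℕ) + 1))) := by
        rw [ENNReal.ofReal_sum_of_nonneg fun n _ => by positivity]
        refine Finset.sum_congr rfl fun n _ => ?_
        rw [ENNReal.ofReal_sum_of_nonneg fun m _ => by positivity]
        refine Finset.sum_congr rfl fun m _ => ?_
        rw [ENNReal.ofReal_mul (by positivity), ENNReal.ofReal_mul (norm_nonneg _), ofReal_norm,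
          ofReal_norm]
    _ ≤ ENNReal.ofReal (8 * M) := by
        gcongr
        exact (hilbert_inequality (fun n => ‖a n‖) N).trans (by gcongr)
    _ = 8 * ENNReal.ofReal M := by rw [ENNReal.ofReal_mul (by norm_num), ENNReal.ofReal_ofNat]

lemma enorm_sum_mul_pow_sq_le (a : ℕ → ℂ) (N : ℕ) {t : ℝ} (ht : 0 ≤ t) :
    ‖(∑ n ∈ Finset.range N, a n * (t : ℂ) ^ n) ^ 2‖ₑ ≤
      ∑ n ∈ Finset.range N, ∑ m ∈ Finset.range N,
        ‖a n‖ₑ * ‖a m‖ₑ * ENNReal.ofReal (t ^ (n + m)) := by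
  have hnorm (n : ℕ) : ‖a n * (t : ℂ) ^ n‖ₑ = ‖a n‖ₑ * ENNReal.ofReal (t ^ n) := by
    rw [enorm_mul, enorm_pow, ← ofReal_norm (t : ℂ), Complex.norm_of_nonneg ht,
      ENNReal.ofReal_pow ht]
  calc ‖(∑ n ∈ Finset.range N, a n * (t : ℂ) ^ n) ^ 2‖ₑ
      ≤ (∑ n ∈ Finset.range N, ‖a n * (t : ℂ) ^ n‖ₑ) ^ 2 := by
        rw [enorm_pow]; gcongr; exact enorm_sum_le _ _
    _ = _ := by
        simp only [sq, Finset.sum_mul_sum, hnorm, pow_add,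
          ENNReal.ofReal_mul (pow_nonneg ht _)]
        exact Finset.sum_congr rfl fun n _ => Finset.sum_congr rfl fun m _ => by ring

lemma IsRadialCarleson.setLIntegral_enorm_sq_le {ν : Measure ℝ} {A : ℝ≥0}
    (hν : IsRadialCarleson ν A) {a : ℕ → ℂ} {h : ℂ → ℂ} (ha : HasPowerSeriesOnDisc a h) {M : ℝ}
    (hM : ∀ N, ∑ n ∈ Finset.range N, ‖a n‖ ^ 2 ≤ M) :
    ∫⁻ t in Ico (0 : ℝ) 1, ‖h t ^ 2‖ₑ ∂ν ≤ 8 * A * ENNReal.ofReal M := by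
  refine lintegral_enorm_le_of_tendsto
    (F := fun N (t : ℝ) => (∑ n ∈ Finset.range N, a n * (t : ℂ) ^ n) ^ 2)
    (fun N => (by fun_prop : Continuous _).aestronglyMeasurable)
    (ae_restrict_of_forall_mem measurableSet_Ico fun t ht =>
      (ha t (ofReal_mem_disc ht)).tendsto_sum_nat.pow 2) (fun N => ?_) tendsto_const_nhds
  calc ∫⁻ t in Ico (0 : ℝ) 1, ‖(∑ n ∈ Finset.range N, a n * (t : ℂ) ^ n) ^ 2‖ₑ ∂ν
      ≤ ∫⁻ t in Ico (0 : ℝ) 1, ∑ n ∈ Finset.range N, ∑ m ∈ Finset.range N,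
          ‖a n‖ₑ * ‖a m‖ₑ * ENNReal.ofReal (t ^ (n + m)) ∂ν :=
        setLIntegral_mono' measurableSet_Ico fun t ht => enorm_sum_mul_pow_sq_le a N ht.1
    _ = ∑ n ∈ Finset.range N, ∑ m ∈ Finset.range N,
          ‖a n‖ₑ * ‖a m‖ₑ * ∫⁻ t in Ico (0 : ℝ) 1, ENNReal.ofReal (t ^ (n + m)) ∂ν := by
        rw [lintegral_finsetSum _ fun n _ => by fun_prop]
        refine Finset.sum_congr rfl fun n _ => ?_
        rw [lintegral_finsetSum _ fun m _ => by fun_prop]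
        exact Finset.sum_congr rfl fun m _ => lintegral_const_mul' _ _ (by finiteness)
    _ ≤ ∑ n ∈ Finset.range N, ∑ m ∈ Finset.range N,
          ‖a n‖ₑ * ‖a m‖ₑ * (A * ENNReal.ofReal (1 / ((n + m : ℕ) + 1))) := by
        gcongr with n _ m _
        exact hν.setLIntegral_pow_le (n + m)
    _ ≤ A * (8 * ENNReal.ofReal M) := by
        simp only [mul_left_comm _ (A : ℝ≥0∞), ← Finset.mul_sum]
        gcongr
        exact hilbert_inequality_enorm a (hM N)
    _ = 8 * A * ENNReal.ofReal M := by rw [mul_left_comm, mul_assoc]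

/-- `g` dominates `p` in the disc, has the modulus of `p` on the unit circle, and is the square of
the holomorphic function `h` in the disc. Replacing `p` by `h` reduces `H¹` estimates to `H²`; for a
polynomial `p`, reflecting the zeros inside the disc provides `g`. -/
structure IsSquareMajorant (p g h : ℂ → ℂ) : Prop where
  continuous : Continuous g
  differentiableOn : DifferentiableOn ℂ h disc
  sq_eq : ∀ z ∈ disc, h z ^ 2 = g z
  norm_eq : ∀ z, ‖z‖ = 1 → ‖g z‖ = ‖p z‖
  norm_le : ∀ z ∈ disc, ‖p z‖ ≤ ‖g z‖

lemma IsSquareMajorant.mul {p g h p' g' h' : ℂ → ℂ} (H : IsSquareMajorant p g h)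
    (H' : IsSquareMajorant p' g' h') :
    IsSquareMajorant (fun z => p z * p' z) (fun z => g z * g' z) (fun z => h z * h' z) where
  continuous := H.continuous.mul H'.continuous
  differentiableOn := H.differentiableOn.mul H'.differentiableOn
  sq_eq z hz := by rw [mul_pow, H.sq_eq z hz, H'.sq_eq z hz]
  norm_eq z hz := by rw [norm_mul, norm_mul, H.norm_eq z hz, H'.norm_eq z hz]
  norm_le z hz := by
    rw [norm_mul, norm_mul]; gcongr
    exacts [H.norm_le z hz, H'.norm_le z hz]

lemma isSquareMajorant_const (c : ℂ) :
    IsSquareMajorant (fun _ => c) (fun _ => c) (fun _ => c ^ ((2 : ℕ) : ℂ)⁻¹) where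
  continuous := continuous_const
  differentiableOn := differentiableOn_const _
  sq_eq _ _ := Complex.cpow_nat_inv_pow c two_ne_zero
  norm_eq _ _ := rfl
  norm_le _ _ := le_rfl

lemma isSquareMajorant_one_sub_mul {u : ℂ} (hu : ‖u‖ ≤ 1) :
    IsSquareMajorant (fun z => 1 - u * z) (fun z => 1 - u * z)
      (fun z => (1 - u * z) ^ ((2 : ℕ) : ℂ)⁻¹) where
  continuous := by fun_prop
  differentiableOn z hz := by
    have hslit : 1 - u * z ∈ Complex.slitPlane := by
      have hlt : (u * z).re < 1 :=
        (Complex.re_le_norm _).trans_lt (mem_disc.1 (mul_mem_disc hu hz))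
      left
      simpa using hlt
    exact ((by fun_prop : DifferentiableAt ℂ (fun z => 1 - u * z) z).cpow_const
      hslit).differentiableWithinAt
  sq_eq z _ := Complex.cpow_nat_inv_pow _ two_ne_zero
  norm_eq _ _ := rfl
  norm_le _ _ := le_rfl

lemma norm_one_sub_conj_mul_sq_sub (a z : ℂ) :
    ‖1 - conj a * z‖ ^ 2 - ‖z - a‖ ^ 2 = (1 - ‖a‖ ^ 2) * (1 - ‖z‖ ^ 2) := by
  simp only [Complex.sq_norm, Complex.normSq_apply, Complex.sub_re, Complex.sub_im, Complex.mul_re,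
    Complex.mul_im, Complex.conj_re, Complex.conj_im, Complex.one_re, Complex.one_im]
  ring

lemma exists_isSquareMajorant_sub (a : ℂ) : ∃ g h, IsSquareMajorant (fun z => z - a) g h := by
  rcases lt_or_ge ‖a‖ 1 with ha | ha
  · have H := isSquareMajorant_one_sub_mul (u := conj a) (by simpa using ha.le)
    refine ⟨_, _, H.continuous, H.differentiableOn, H.sq_eq, fun z hz => ?_, fun z hz => ?_⟩
    · rw [← sq_eq_sq₀ (norm_nonneg _) (norm_nonneg _), ← sub_eq_zero,
        norm_one_sub_conj_mul_sq_sub, hz]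
      ring
    · rw [← sq_le_sq₀ (norm_nonneg _) (norm_nonneg _), ← sub_nonneg, norm_one_sub_conj_mul_sq_sub]
      exact mul_nonneg (sub_nonneg.2 (pow_le_one₀ (norm_nonneg _) ha.le))
        (sub_nonneg.2 (pow_le_one₀ (norm_nonneg _) (mem_disc.1 hz).le))
  · have ha0 : a ≠ 0 := norm_pos_iff.1 (one_pos.trans_le ha)
    have H := (isSquareMajorant_const (-a)).mul (isSquareMajorant_one_sub_mul (u := a⁻¹)
      (by rw [norm_inv]; exact inv_le_one_of_one_le₀ ha))
    have hfactor : (fun z => -a * (1 - a⁻¹ * z)) = fun z => z - a := by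
      ext z; field_simp; ring
    exact ⟨_, _, hfactor ▸ H⟩

lemma exists_isSquareMajorant (p : Polynomial ℂ) :
    ∃ g h, IsSquareMajorant (fun z => p.eval z) g h := by
  have hprod (s : Multiset ℂ) :
      ∃ g h, IsSquareMajorant (fun z => (s.map fun a => z - a).prod) g h := by
    induction s using Multiset.induction with
    | empty => exact ⟨_, _, by simpa using isSquareMajorant_const 1⟩
    | cons a s ih =>
      obtain ⟨g, h, H⟩ := ih
      obtain ⟨g', h', H'⟩ := exists_isSquareMajorant_sub a
      exact ⟨_, _, by simpa using H'.mul H⟩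
  obtain ⟨g, h, H⟩ := hprod p.roots
  simp only [(IsAlgClosed.splits p).eval_eq_prod_roots]
  exact ⟨_, _, (isSquareMajorant_const p.leadingCoeff).mul H⟩

lemma IsSquareMajorant.sum_norm_sq_le {p g h : ℂ → ℂ} (H : IsSquareMajorant p g h) {a : ℕ → ℂ}
    (ha : HasPowerSeriesOnDisc a h) (N : ℕ) :
    ∑ n ∈ Finset.range N, ‖a n‖ ^ 2 ≤ circleAverage (fun z => ‖p z‖) 0 1 := by
  have hg := H.continuous
  have hcoeff : Continuous fun ρ : ℝ => ∑ n ∈ Finset.range N, ‖a n‖ ^ 2 * ρ ^ (2 * n) := by fun_prop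
  have hmean : Continuous fun ρ : ℝ => circleAverage (fun z => ‖g z‖) 0 ρ := by fun_prop
  have parseval_le : ∀ᶠ ρ in 𝓝[<] (1 : ℝ), ∑ n ∈ Finset.range N, ‖a n‖ ^ 2 * ρ ^ (2 * n) ≤
      circleAverage (fun z => ‖g z‖) 0 ρ := by
    filter_upwards [Ioo_mem_nhdsLT (zero_lt_one : (0 : ℝ) < 1)] with ρ hρ
    have hh : circleAverage (fun z => ‖h z‖ ^ 2) 0 ρ = circleAverage (fun z => ‖g z‖) 0 ρ := by
      refine Real.circleAverage_congr_sphere fun z hz => ?_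
      rw [mem_sphere_zero_iff_norm, abs_of_pos hρ.1] at hz
      simp only [← H.sq_eq z (mem_disc.2 (hz ▸ hρ.2)), norm_pow]
    have hρ0 := hρ.1
    exact hh ▸ sum_le_hasSum _ (fun n _ => by positivity)
      (ha.onCircle (Ioo_subset_Ico_self hρ)).hasSum_circleAverage_norm_sq
  have hboundary : circleAverage (fun z => ‖g z‖) 0 1 = circleAverage (fun z => ‖p z‖) 0 1 :=
    Real.circleAverage_congr_sphere fun z hz => H.norm_eq z (by simpa using hz)
  simpa [hboundary] using le_of_tendsto_of_tendsto hcoeff.continuousWithinAt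
    hmean.continuousWithinAt parseval_le

lemma IsRadialCarleson.setLIntegral_enorm_polynomial_le {ν : Measure ℝ} {A : ℝ≥0}
    (hν : IsRadialCarleson ν A) (p : Polynomial ℂ) :
    ∫⁻ t in Ico (0 : ℝ) 1, ‖p.eval (t : ℂ)‖ₑ ∂ν ≤
      8 * A * ENNReal.ofReal (circleAverage (fun z => ‖p.eval z‖) 0 1) := by
  obtain ⟨g, h, H⟩ := exists_isSquareMajorant p
  obtain ⟨a, ha⟩ := exists_hasPowerSeriesOnDisc H.differentiableOn
  refine le_trans (setLIntegral_mono' measurableSet_Ico fun t ht => ?_)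
    (hν.setLIntegral_enorm_sq_le ha (H.sum_norm_sq_le ha))
  rw [H.sq_eq _ (ofReal_mem_disc ht), enorm_le_iff_norm_le]
  exact H.norm_le _ (ofReal_mem_disc ht)

lemma HasPowerSeriesOnCircle.tendsto_circleAverage_norm_sum {a : ℕ → ℂ} {ρ : ℝ} {F : ℂ → ℂ}
    (H : HasPowerSeriesOnCircle a ρ F) :
    Tendsto (fun N => circleAverage (fun z => ‖∑ n ∈ Finset.range N, a n * z ^ n‖) 0 ρ) atTop
      (𝓝 (circleAverage (fun z => ‖F z‖) 0 ρ)) := by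
  have hnorm (θ : ℝ) : ‖circleMap 0 ρ θ‖ = ρ := by
    rw [norm_circleMap_zero, abs_of_nonneg H.radius_nonneg]
  simp only [Real.circleAverage_def]
  refine (intervalIntegral.tendsto_integral_filter_of_dominated_convergence
    (fun _ => ∑' n, ‖a n‖ * ρ ^ n) (.of_forall fun N => ?_)
    (.of_forall fun N => .of_forall fun θ _ => ?_) intervalIntegrable_const
    (.of_forall fun θ _ => (H.hasSum _ (hnorm θ)).tendsto_sum_nat.norm)).const_smul _
  · exact (by fun_prop : Continuous _).aestronglyMeasurable
  · rw [norm_norm]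
    calc ‖∑ n ∈ Finset.range N, a n * circleMap 0 ρ θ ^ n‖
        ≤ ∑ n ∈ Finset.range N, ‖a n * circleMap 0 ρ θ ^ n‖ := norm_sum_le _ _
      _ = ∑ n ∈ Finset.range N, ‖a n‖ * ρ ^ n := by simp only [norm_mul, norm_pow, hnorm]
      _ ≤ ∑' n, ‖a n‖ * ρ ^ n := H.summable.sum_le_tsum _ fun n _ =>
          mul_nonneg (norm_nonneg _) (pow_nonneg H.radius_nonneg n)

lemma circleAverage_norm_le_hardyNorm (f : ℂ → ℂ) {r : ℝ} (hr : r ∈ Ioo (0 : ℝ) 1) :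
    ENNReal.ofReal (circleAverage (fun z => ‖f z‖) 0 r) ≤ hardyNorm f :=
  le_iSup₂ (f := fun (r : ℝ) (_ : r ∈ Ioo (0 : ℝ) 1) =>
    ENNReal.ofReal (circleAverage (fun z : ℂ => ‖f z‖) 0 r)) r hr

lemma IsRadialCarleson.setLIntegral_enorm_dilation_le {ν : Measure ℝ} {A : ℝ≥0}
    (hν : IsRadialCarleson ν A) {f : ℂ → ℂ} (hf : DifferentiableOn ℂ f disc) {r : ℝ}
    (hr : r ∈ Ioo (0 : ℝ) 1) :
    ∫⁻ t in Ico (0 : ℝ) 1, ‖f (r * t)‖ₑ ∂ν ≤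
      8 * A * ENNReal.ofReal (circleAverage (fun z => ‖f z‖) 0 r) := by
  obtain ⟨a, ha⟩ := exists_hasPowerSeriesOnDisc hf
  let p (N : ℕ) : Polynomial ℂ :=
    ∑ n ∈ Finset.range N, Polynomial.C (a n * r ^ n) * Polynomial.X ^ n
  have eval_p (N : ℕ) (z : ℂ) : (p N).eval z = ∑ n ∈ Finset.range N, a n * (r * z) ^ n := by
    simp [p, Polynomial.eval_finsetSum, mul_pow, mul_assoc]
  have average_p (N : ℕ) : circleAverage (fun z => ‖(p N).eval z‖) 0 1 =
      circleAverage (fun z => ‖∑ n ∈ Finset.range N, a n * z ^ n‖) 0 r := by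
    simp [Real.circleAverage_def, eval_p, circleMap]
  have hr_norm : ‖(r : ℂ)‖ ≤ 1 := by simpa [abs_of_pos hr.1] using hr.2.le
  refine lintegral_enorm_le_of_tendsto (F := fun N (t : ℝ) => (p N).eval (t : ℂ))
    (fun N => ((p N).continuous.comp Complex.continuous_ofReal).aestronglyMeasurable)
    (ae_restrict_of_forall_mem measurableSet_Ico fun t ht => ?_)
    (fun N => (hν.setLIntegral_enorm_polynomial_le (p N)).trans_eq (by rw [average_p]))
    (ENNReal.Tendsto.const_mul (ENNReal.tendsto_ofReal
      (ha.onCircle (Ioo_subset_Ico_self hr)).tendsto_circleAverage_norm_sum)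
      (Or.inr (by finiteness)))
  simp only [eval_p]
  exact (ha _ (mul_mem_disc hr_norm (ofReal_mem_disc ht))).tendsto_sum_nat

theorem IsRadialCarleson.setLIntegral_enorm_le_hardyNorm {ν : Measure ℝ} {A : ℝ≥0}
    (hν : IsRadialCarleson ν A) {f : ℂ → ℂ} (hf : DifferentiableOn ℂ f disc) :
    ∫⁻ t in Ico (0 : ℝ) 1, ‖f t‖ₑ ∂ν ≤ 8 * A * hardyNorm f := by
  obtain ⟨r, -, hr, hr_lim⟩ := exists_seq_strictMono_tendsto' (zero_lt_one : (0 : ℝ) < 1)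
  have hmem (N : ℕ) {t : ℝ} (ht : t ∈ Ico (0 : ℝ) 1) : (r N * t : ℂ) ∈ disc :=
    mul_mem_disc (by simpa [abs_of_pos (hr N).1] using (hr N).2.le) (ofReal_mem_disc ht)
  refine lintegral_enorm_le_of_tendsto (F := fun N (t : ℝ) => f (r N * t))
    (fun N => ContinuousOn.aestronglyMeasurable
      (hf.continuousOn.comp (by fun_prop) fun t ht => hmem N ht) measurableSet_Ico)
    (ae_restrict_of_forall_mem measurableSet_Ico fun t ht => ?_)
    (fun N => (hν.setLIntegral_enorm_dilation_le hf (hr N)).trans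
      (by gcongr; exact circleAverage_norm_le_hardyNorm f (hr N))) tendsto_const_nhds
  have hcont : ContinuousAt f (t : ℂ) :=
    hf.continuousOn.continuousAt (isOpen_disc.mem_nhds (ofReal_mem_disc ht))
  have harg : Tendsto (fun N => (r N : ℂ) * t) atTop (𝓝 t) := by
    simpa using ((Complex.continuous_ofReal.tendsto 1).comp hr_lim).mul_const (t : ℂ)
  exact hcont.tendsto.comp harg

/-! ### Tails and moments of a radial weight -/

/-- The moment `∫_0^1 rⁿ ω(r) dr` of the weight `ω`. -/
def moment (ω : ℝ → ℝ) (n : ℕ) : ℝ := ∫ r in Ico (0 : ℝ) 1, r ^ n * ω r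

/-- The factor `t ↦ 1 + ∫_0^t ds / ω̂(s)` by which the weight is multiplied in
`carlesonDensity`. -/
def tailWeight (ω : ℝ → ℝ) (t : ℝ) : ℝ := 1 + ∫ s in (0 : ℝ)..t, 1 / tail ω s

/-- The radius `1 - 1 / (m + 1)` beyond which `r ^ m` is comparable to `1`: it matches the moment of
order `m` with a tail integral. -/
def momentRadius (m : ℕ) : ℝ := 1 - 1 / ((m : ℝ) + 1)

lemma one_add_div_two_mem {r : ℝ} (hr : r ∈ Ico (0 : ℝ) 1) : (1 + r) / 2 ∈ Ico (0 : ℝ) 1 := by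
  constructor <;> linarith [hr.1, hr.2]

lemma one_sub_momentRadius (m : ℕ) : 1 - momentRadius m = 1 / ((m : ℝ) + 1) := sub_sub_cancel _ _

lemma momentRadius_mem (m : ℕ) : momentRadius m ∈ Ico (0 : ℝ) 1 := by
  have hpos : (0 : ℝ) < 1 / ((m : ℝ) + 1) := by positivity
  have hle : 1 / ((m : ℝ) + 1) ≤ 1 := div_le_one_of_le₀ (by simp) (by positivity)
  have := one_sub_momentRadius m
  constructor <;> linarith

lemma momentRadius_mono : Monotone momentRadius := fun m n hmn => by
  unfold momentRadius
  gcongr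

lemma exists_momentRadius_le_le {y : ℝ} (hy : y ∈ Ico (0 : ℝ) 1) :
    ∃ m : ℕ, momentRadius m ≤ y ∧ y ≤ momentRadius (m + 1) := by
  have hy1 : 0 < 1 - y := sub_pos.2 hy.2
  have hone : 1 ≤ 1 / (1 - y) := (one_le_div hy1).2 (sub_le_self 1 hy.1)
  obtain ⟨m, hm⟩ := Nat.exists_eq_add_of_le' (Nat.one_le_floor_iff _ |>.2 hone)
  have hle := Nat.floor_le (zero_le_one.trans hone)
  have hlt := Nat.lt_floor_add_one (1 / (1 - y))
  rw [hm, Nat.cast_add_one] at hle hlt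
  refine ⟨m, sub_le_comm.1 ?_, le_sub_comm.1 ?_⟩
  · rwa [le_one_div hy1 (by positivity)]
  · rw [Nat.cast_add_one, one_div_le (by positivity) hy1]
    exact hlt.le

lemma one_div_four_le_momentRadius_pow (m : ℕ) : 1 / 4 ≤ momentRadius m ^ m := by
  rcases m.eq_zero_or_pos with rfl | hm
  · norm_num
  have hinv : momentRadius m = (1 + 1 / (m : ℝ))⁻¹ := by
    rw [momentRadius]
    field_simp
    ring
  rw [hinv, inv_pow, one_div]
  refine inv_anti₀ (by positivity) ?_
  calc (1 + 1 / (m : ℝ)) ^ m ≤ Real.exp (1 / m) ^ m := by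
        gcongr
        linarith [Real.add_one_le_exp (1 / (m : ℝ))]
    _ = Real.exp 1 := by rw [← Real.exp_nat_mul, mul_one_div_cancel (by positivity)]
    _ ≤ 4 := by linarith [Real.exp_one_lt_d9]

lemma natCast_mul_pow_mul_one_sub_le_one {r : ℝ} (hr : r ∈ Icc (0 : ℝ) 1) (n : ℕ) :
    n * (r ^ n * (1 - r)) ≤ 1 := by
  have hgeom : n * r ^ n ≤ ∑ i ∈ Finset.range n, r ^ i := by
    simpa using Finset.sum_le_sum fun i hi =>
      pow_le_pow_of_le_one hr.1 hr.2 (Finset.mem_range.1 hi).le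
  calc n * (r ^ n * (1 - r)) = n * r ^ n * (1 - r) := (mul_assoc _ _ _).symm
    _ ≤ (∑ i ∈ Finset.range n, r ^ i) * (1 - r) :=
        mul_le_mul_of_nonneg_right hgeom (sub_nonneg.2 hr.2)
    _ = 1 - r ^ n := geom_sum_mul_neg r n
    _ ≤ 1 := sub_le_self _ (pow_nonneg hr.1 n)

lemma pow_sub_pow_add_two_le {r : ℝ} (hr : r ∈ Icc (0 : ℝ) 1) (k : ℕ) :
    r ^ (2 * k + 1) - r ^ (2 * k + 3) ≤ 2 / (k + 1 : ℕ) * r ^ k := by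
  have hk : (0 : ℝ) < (k + 1 : ℕ) := by positivity
  have h0 : 0 ≤ r ^ k := pow_nonneg hr.1 k
  rw [div_mul_eq_mul_div, le_div_iff₀ hk]
  calc (r ^ (2 * k + 1) - r ^ (2 * k + 3)) * (k + 1 : ℕ)
      = r ^ k * (1 + r) * ((k + 1 : ℕ) * (r ^ (k + 1) * (1 - r))) := by ring
    _ ≤ r ^ k * (1 + 1) * 1 := by
        gcongr
        exacts [mul_nonneg (Nat.cast_nonneg _) (mul_nonneg (pow_nonneg hr.1 _) (sub_nonneg.2 hr.2)),
          hr.2, natCast_mul_pow_mul_one_sub_le_one hr _]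
    _ = 2 * r ^ k := by ring

lemma tail_eq_setIntegral (ω : ℝ → ℝ) {r : ℝ} (hr : r ≤ 1) :
    tail ω r = ∫ s in Ico r 1, ω s := by
  rw [tail, intervalIntegral.integral_of_le hr, integral_Ico_eq_integral_Ioc]

namespace IsRadialWeight

variable {ω : ℝ → ℝ}

lemma tail_anti (hω : IsRadialWeight ω) {r s : ℝ} (hr : 0 ≤ r) (hrs : r ≤ s) (hs : s ≤ 1) :
    tail ω s ≤ tail ω r := by
  rw [tail_eq_setIntegral ω hs, tail_eq_setIntegral ω (hrs.trans hs)]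
  exact setIntegral_mono_set (hω.integrable.mono_set (Ico_subset_Ico_left hr))
    (ae_restrict_of_forall_mem measurableSet_Ico fun x hx => hω.nonneg x ⟨hr.trans hx.1, hx.2⟩)
    (Ico_subset_Ico_left hrs).eventuallyLE

lemma continuousOn_tail (hω : IsRadialWeight ω) : ContinuousOn (tail ω) (Icc 0 1) := by
  have h := intervalIntegral.continuousOn_primitive_interval_left (μ := volume) (f := ω)
    (a := 0) (b := 1) (by
      rw [uIcc_of_le zero_le_one, integrableOn_Icc_iff_integrableOn_Ico]
      exact hω.integrable)
  rwa [uIcc_of_le zero_le_one] at h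

lemma continuousOn_inv_tail (hω : IsRadialWeight ω) :
    ContinuousOn (fun s => 1 / tail ω s) (Ico 0 1) :=
  continuousOn_const.div (hω.continuousOn_tail.mono Ico_subset_Icc_self)
    fun s hs => (hω.tail_pos s hs).ne'

lemma intervalIntegrable_inv_tail (hω : IsRadialWeight ω) {a b : ℝ} (ha : a ∈ Ico (0 : ℝ) 1)
    (hb : b ∈ Ico (0 : ℝ) 1) : IntervalIntegrable (fun s => 1 / tail ω s) volume a b :=
  (hω.continuousOn_inv_tail.mono (ordConnected_Ico.uIcc_subset ha hb)).intervalIntegrable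

lemma tailWeight_sub (hω : IsRadialWeight ω) {a b : ℝ} (ha : a ∈ Ico (0 : ℝ) 1)
    (hb : b ∈ Ico (0 : ℝ) 1) :
    tailWeight ω b - tailWeight ω a = ∫ s in a..b, 1 / tail ω s := by
  have h0 : (0 : ℝ) ∈ Ico (0 : ℝ) 1 := left_mem_Ico.2 one_pos
  rw [tailWeight, tailWeight, add_sub_add_left_eq_sub]
  exact intervalIntegral.integral_interval_sub_left (hω.intervalIntegrable_inv_tail h0 hb)
    (hω.intervalIntegrable_inv_tail h0 ha)

lemma div_tail_le_integral (hω : IsRadialWeight ω) {a b : ℝ} (ha : 0 ≤ a) (hab : a ≤ b)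
    (hb : b < 1) : (b - a) / tail ω a ≤ ∫ s in a..b, 1 / tail ω s := by
  have h : ∫ _ in a..b, 1 / tail ω a ≤ ∫ s in a..b, 1 / tail ω s :=
    intervalIntegral.integral_mono_on hab intervalIntegrable_const
      (hω.intervalIntegrable_inv_tail ⟨ha, hab.trans_lt hb⟩ ⟨ha.trans hab, hb⟩) fun s hs =>
        one_div_le_one_div_of_le (hω.tail_pos s ⟨ha.trans hs.1, hs.2.trans_lt hb⟩)
          (hω.tail_anti ha hs.1 (hs.2.trans hb.le))
  simpa [div_eq_mul_inv] using h

lemma integral_le_div_tail (hω : IsRadialWeight ω) {a b : ℝ} (ha : 0 ≤ a) (hab : a ≤ b)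
    (hb : b < 1) : ∫ s in a..b, 1 / tail ω s ≤ (b - a) / tail ω b := by
  have h : ∫ s in a..b, 1 / tail ω s ≤ ∫ _ in a..b, 1 / tail ω b :=
    intervalIntegral.integral_mono_on hab
      (hω.intervalIntegrable_inv_tail ⟨ha, hab.trans_lt hb⟩ ⟨ha.trans hab, hb⟩)
      intervalIntegrable_const fun s hs =>
        one_div_le_one_div_of_le (hω.tail_pos b ⟨ha.trans hab, hb⟩)
          (hω.tail_anti (ha.trans hs.1) hs.2 hb.le)
  simpa [div_eq_mul_inv] using h

lemma tailWeight_mono (hω : IsRadialWeight ω) {a b : ℝ} (ha : 0 ≤ a) (hab : a ≤ b)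
    (hb : b < 1) : tailWeight ω a ≤ tailWeight ω b := by
  have ha1 : a ∈ Ico (0 : ℝ) 1 := ⟨ha, hab.trans_lt hb⟩
  rw [← sub_nonneg, hω.tailWeight_sub ha1 ⟨ha.trans hab, hb⟩]
  exact (div_nonneg (sub_nonneg.2 hab) (hω.tail_pos a ha1).le).trans
    (hω.div_tail_le_integral ha hab hb)

lemma one_le_tailWeight (hω : IsRadialWeight ω) {a : ℝ} (ha : a ∈ Ico (0 : ℝ) 1) :
    1 ≤ tailWeight ω a := by
  simpa [tailWeight] using hω.tailWeight_mono le_rfl ha.1 ha.2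

lemma continuousOn_tailWeight (hω : IsRadialWeight ω) : ContinuousOn (tailWeight ω) (Ico 0 1) := by
  intro t ht
  obtain ⟨b, htb, hb1⟩ := exists_between ht.2
  have h0b : 0 ≤ b := ht.1.trans htb.le
  have hprim := intervalIntegral.continuousOn_primitive_interval (μ := volume)
    (f := fun s => 1 / tail ω s) (a := 0) (b := b) (by
      rw [uIcc_of_le h0b]
      exact (hω.continuousOn_inv_tail.mono (Icc_subset_Ico_right hb1)).integrableOn_compact
        isCompact_Icc)
  rw [uIcc_of_le h0b] at hprim
  have hwithin : ContinuousWithinAt (tailWeight ω) (Icc 0 b) t :=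
    continuousWithinAt_const.add (hprim t ⟨ht.1, htb.le⟩)
  refine hwithin.mono_of_mem_nhdsWithin ?_
  filter_upwards [self_mem_nhdsWithin, mem_nhdsWithin_of_mem_nhds (Iio_mem_nhds htb)] with s hs hsb
  exact ⟨hs.1, le_of_lt hsb⟩

lemma integrableOn_pow_mul (hω : IsRadialWeight ω) (n : ℕ) :
    IntegrableOn (fun r => r ^ n * ω r) (Ico 0 1) volume := by
  refine Integrable.mono' hω.integrable
    ((continuous_pow n).aestronglyMeasurable.mul hω.integrable.1)
    (ae_restrict_of_forall_mem measurableSet_Ico fun r hr => ?_)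
  have hωr := hω.nonneg r hr
  rw [Real.norm_of_nonneg (mul_nonneg (pow_nonneg hr.1 n) hωr)]
  exact mul_le_of_le_one_left hωr (pow_le_one₀ hr.1 hr.2.le)

lemma setIntegral_mul_mono (hω : IsRadialWeight ω) {f g : ℝ → ℝ}
    (hf : IntegrableOn (fun r => f r * ω r) (Ico 0 1))
    (hg : IntegrableOn (fun r => g r * ω r) (Ico 0 1)) (h : ∀ r ∈ Ico (0 : ℝ) 1, f r ≤ g r) :
    ∫ r in Ico (0 : ℝ) 1, f r * ω r ≤ ∫ r in Ico (0 : ℝ) 1, g r * ω r :=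
  setIntegral_mono_on hf hg measurableSet_Ico fun r hr =>
    mul_le_mul_of_nonneg_right (h r hr) (hω.nonneg r hr)

lemma moment_antitone (hω : IsRadialWeight ω) : Antitone (moment ω) := fun _ _ hnm =>
  hω.setIntegral_mul_mono (hω.integrableOn_pow_mul _) (hω.integrableOn_pow_mul _) fun _ hr =>
    pow_le_pow_of_le_one hr.1 hr.2.le hnm

lemma moment_le_tail_zero (hω : IsRadialWeight ω) (m : ℕ) : moment ω m ≤ tail ω 0 := by
  simpa [moment, tail_eq_setIntegral ω zero_le_one] using hω.moment_antitone m.zero_le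

lemma setIntegral_indicator_mul (hω : IsRadialWeight ω) {u : ℝ} (hu : u ∈ Ico (0 : ℝ) 1) (c : ℝ) :
    IntegrableOn (fun r => (Ici u).indicator (fun _ => c) r * ω r) (Ico 0 1) ∧
      ∫ r in Ico (0 : ℝ) 1, (Ici u).indicator (fun _ => c) r * ω r = c * tail ω u := by
  have heq : (fun r => (Ici u).indicator (fun _ => c) r * ω r) =
      (Ici u).indicator fun r => c * ω r := by
    ext r
    exact (indicator_mul_left _ _ _).symm
  have hset : Ico 0 1 ∩ Ici u = Ico u 1 := by
    ext r
    simp only [mem_inter_iff, mem_Ico, mem_Ici]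
    grind
  rw [heq, setIntegral_indicator measurableSet_Ici, hset, integral_const_mul,
    tail_eq_setIntegral ω hu.2.le]
  exact ⟨(hω.integrable.const_mul c).indicator measurableSet_Ici, rfl⟩

lemma pow_mul_tail_le_moment (hω : IsRadialWeight ω) {u : ℝ} (hu : u ∈ Ico (0 : ℝ) 1) (n : ℕ) :
    u ^ n * tail ω u ≤ moment ω n := by
  obtain ⟨hint, heq⟩ := hω.setIntegral_indicator_mul hu (u ^ n)
  rw [← heq]
  refine hω.setIntegral_mul_mono hint (hω.integrableOn_pow_mul n) fun r hr => ?_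
  exact indicator_apply_le' (fun hur => pow_le_pow_left₀ hu.1 hur n) fun _ => pow_nonneg hr.1 n

lemma tail_le_moment (hω : IsRadialWeight ω) (m : ℕ) :
    tail ω (momentRadius m) ≤ 4 * moment ω m := by
  have hmom := hω.pow_mul_tail_le_moment (momentRadius_mem m) m
  have hpow := mul_le_mul_of_nonneg_right (one_div_four_le_momentRadius_pow m)
    (hω.tail_pos _ (momentRadius_mem m)).le
  linarith

lemma moment_pos (hω : IsRadialWeight ω) (n : ℕ) : 0 < moment ω n := by
  linarith [hω.tail_pos _ (momentRadius_mem n), hω.tail_le_moment n]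

lemma moment_add_le (hω : IsRadialWeight ω) {u : ℝ} (hu : u ∈ Ico (0 : ℝ) 1) (n k : ℕ) :
    moment ω (n + k) ≤ tail ω u + u ^ k * moment ω n := by
  obtain ⟨hint, heq⟩ := hω.setIntegral_indicator_mul hu 1
  have hint' := (hω.integrableOn_pow_mul n).const_mul (u ^ k)
  have hsum : tail ω u + u ^ k * moment ω n =
      ∫ r in Ico (0 : ℝ) 1, ((Ici u).indicator (fun _ => 1) r + u ^ k * r ^ n) * ω r := by
    simp only [add_mul, mul_assoc]
    rw [integral_add hint hint', heq, one_mul, moment, integral_const_mul]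
  rw [hsum]
  refine hω.setIntegral_mul_mono (hω.integrableOn_pow_mul _) ?_ fun r hr => ?_
  · simp only [add_mul, mul_assoc]
    exact hint.add hint'
  · have hpow : 0 ≤ u ^ k * r ^ n := mul_nonneg (pow_nonneg hu.1 k) (pow_nonneg hr.1 n)
    by_cases hur : u ≤ r
    · rw [indicator_of_mem (mem_Ici.2 hur)]
      linarith [pow_le_one₀ (n := n + k) hr.1 hr.2.le]
    · rw [indicator_of_notMem (notMem_Ici.2 (not_le.1 hur)), zero_add, pow_add, mul_comm]
      exact mul_le_mul_of_nonneg_right (pow_le_pow_left₀ hr.1 (not_le.1 hur).le k)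
        (pow_nonneg hr.1 n)

lemma moment_sub_le (hω : IsRadialWeight ω) (k : ℕ) :
    moment ω (2 * k + 1) - moment ω (2 * k + 3) ≤ 2 / (k + 1 : ℕ) * moment ω k := by
  have hleft : moment ω (2 * k + 1) - moment ω (2 * k + 3) =
      ∫ r in Ico (0 : ℝ) 1, (r ^ (2 * k + 1) - r ^ (2 * k + 3)) * ω r := by
    simp only [moment, sub_mul]
    rw [integral_sub (hω.integrableOn_pow_mul _) (hω.integrableOn_pow_mul _)]
  have hright : 2 / (k + 1 : ℕ) * moment ω k =
      ∫ r in Ico (0 : ℝ) 1, (2 / (k + 1 : ℕ) * r ^ k) * ω r := by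
    simp only [moment, ← integral_const_mul, mul_assoc]
  rw [hleft, hright]
  refine hω.setIntegral_mul_mono ?_ ?_ fun r hr => pow_sub_pow_add_two_le ⟨hr.1, hr.2.le⟩ k
  · simp only [sub_mul]
    exact (hω.integrableOn_pow_mul _).sub (hω.integrableOn_pow_mul _)
  · simp only [mul_assoc]
    exact (hω.integrableOn_pow_mul _).const_mul _

lemma tail_le_pow_mul_of_le (hω : IsRadialWeight ω) {C : ℝ} (hC : 0 ≤ C)
    (hdouble : ∀ r ∈ Ico (0 : ℝ) 1, tail ω r ≤ C * tail ω ((1 + r) / 2)) {r s : ℝ}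
    (hr : r ∈ Ico (0 : ℝ) 1) (hs : s ∈ Ico (0 : ℝ) 1) {j : ℕ} (hrs : 1 - r ≤ 2 ^ j * (1 - s)) :
    tail ω r ≤ C ^ j * tail ω s := by
  induction j generalizing r with
  | zero => simpa using hω.tail_anti hs.1 (by linarith) hr.2.le
  | succ j ih =>
    have hih : tail ω ((1 + r) / 2) ≤ C ^ j * tail ω s :=
      ih (one_add_div_two_mem hr) (by rw [pow_succ] at hrs; linarith)
    calc tail ω r ≤ C * tail ω ((1 + r) / 2) := hdouble r hr
      _ ≤ C * (C ^ j * tail ω s) := by gcongr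
      _ = C ^ (j + 1) * tail ω s := by ring

-- Splitting the integral at `u = 1 - 2 ^ j / (m + 1)` costs a tail and leaves the moment of order
-- `m / 2` with a factor `u ^ (m / 2)`, small enough to compensate the doubling constant.
lemma moment_le_tail_add_of_le (hω : IsRadialWeight ω) {C : ℝ} (hC : 0 ≤ C)
    (hdouble : ∀ r ∈ Ico (0 : ℝ) 1, tail ω r ≤ C * tail ω ((1 + r) / 2)) {j m : ℕ}
    (hjm : (2 : ℝ) ^ j ≤ m + 1) (hm : m ≠ 0) :
    moment ω m ≤ C ^ j * tail ω (momentRadius m) + 4 / 2 ^ j * moment ω (m / 2) := by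
  set u : ℝ := 1 - 2 ^ j / ((m : ℝ) + 1) with hu_def
  have hu : u ∈ Ico (0 : ℝ) 1 := by
    have hpos : 0 < (2 : ℝ) ^ j / ((m : ℝ) + 1) := by positivity
    have hle : (2 : ℝ) ^ j / ((m : ℝ) + 1) ≤ 1 := div_le_one_of_le₀ hjm (by positivity)
    constructor <;> linarith
  have hsplit := hω.moment_add_le hu (m / 2) (m - m / 2)
  rw [Nat.add_sub_cancel' (Nat.div_le_self m 2)] at hsplit
  have htail : tail ω u ≤ C ^ j * tail ω (momentRadius m) :=
    hω.tail_le_pow_mul_of_le hC hdouble hu (momentRadius_mem m) (by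
      rw [one_sub_momentRadius, mul_one_div, hu_def, sub_sub_cancel])
  have hpow : u ^ (m - m / 2) ≤ 4 / 2 ^ j := by
    have hk : ((m : ℝ) + 1) / 4 ≤ (m - m / 2 : ℕ) := by
      have : m + 1 ≤ (m - m / 2) * 4 := by lia
      rw [div_le_iff₀ four_pos]
      exact_mod_cast this
    have hbound := natCast_mul_pow_mul_one_sub_le_one ⟨hu.1, hu.2.le⟩ (m - m / 2)
    rw [hu_def, sub_sub_cancel, ← hu_def] at hbound
    rw [le_div_iff₀ (by positivity)]
    calc u ^ (m - m / 2) * 2 ^ j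
        = 4 * (((m : ℝ) + 1) / 4 * (u ^ (m - m / 2) * (2 ^ j / ((m : ℝ) + 1)))) := by
          field_simp
      _ ≤ 4 * ((m - m / 2 : ℕ) * (u ^ (m - m / 2) * (2 ^ j / ((m : ℝ) + 1)))) := by
          have := pow_nonneg hu.1 (m - m / 2)
          gcongr
      _ ≤ 4 := by linarith
  calc moment ω m ≤ tail ω u + u ^ (m - m / 2) * moment ω (m / 2) := hsplit
    _ ≤ _ := add_le_add htail (mul_le_mul_of_nonneg_right hpow (hω.moment_pos _).le)

end IsRadialWeight

namespace IsUpperDoubling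

variable {ω : ℝ → ℝ}

lemma exists_tail_momentRadius_le (hω : IsUpperDoubling ω) (j : ℕ) :
    ∃ K : ℝ, 0 < K ∧ ∀ {m : ℕ} {r : ℝ}, r ∈ Ico (0 : ℝ) 1 → (m + 1) * (1 - r) ≤ 2 ^ j →
      tail ω r ≤ K * tail ω (momentRadius m) := by
  obtain ⟨C, hC, hdouble⟩ := hω.doubling
  refine ⟨C ^ j, by positivity, fun {m r} hr hrm => ?_⟩
  refine hω.radialWeight.tail_le_pow_mul_of_le (by positivity) hdouble hr (momentRadius_mem m) ?_
  rwa [one_sub_momentRadius, mul_one_div, le_div_iff₀' (by positivity)]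

lemma exists_moment_le_tail (hω : IsUpperDoubling ω) :
    ∃ K : ℝ, 0 < K ∧ ∀ m : ℕ, moment ω m ≤ K * tail ω (momentRadius m) := by
  obtain ⟨C, hC, hdouble⟩ := hω.doubling
  have hC0 : 0 ≤ C := zero_le_one.trans hC
  have h := hω.radialWeight
  obtain ⟨j, hj⟩ := pow_unbounded_of_one_lt (8 * C) (one_lt_two : (1 : ℝ) < 2)
  refine ⟨2 * C ^ j, by positivity, fun m => ?_⟩
  induction m using Nat.strong_induction_on with
  | _ m ih =>
  have htail := h.tail_pos _ (momentRadius_mem m)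
  rcases le_or_gt ((m : ℝ) + 1) (2 ^ j) with hsmall | hlarge
  · have h0 : tail ω 0 ≤ C ^ j * tail ω (momentRadius m) :=
      h.tail_le_pow_mul_of_le hC0 hdouble (left_mem_Ico.2 one_pos) (momentRadius_mem m) (by
        rwa [one_sub_momentRadius, mul_one_div, le_div_iff₀ (by positivity), sub_zero, one_mul])
    linarith [h.moment_le_tail_zero m, mul_pos (pow_pos (one_pos.trans_le hC) j) htail]
  · have hm : m ≠ 0 := by
      rintro rfl
      rw [Nat.cast_zero, zero_add] at hlarge
      exact absurd hlarge (one_le_pow₀ one_le_two).not_gt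
    have hhalf : tail ω (momentRadius (m / 2)) ≤ C * tail ω (momentRadius m) := by
      simpa using h.tail_le_pow_mul_of_le (j := 1) hC0 hdouble (momentRadius_mem (m / 2))
        (momentRadius_mem m) (by
          have : (m : ℝ) + 1 ≤ 2 * ((m / 2 : ℕ) + 1) := by exact_mod_cast (by lia)
          rw [one_sub_momentRadius, one_sub_momentRadius, pow_one, mul_one_div,
            div_le_div_iff₀ (by positivity) (by positivity), one_mul]
          exact this)
    calc moment ω m ≤ C ^ j * tail ω (momentRadius m) + 4 / 2 ^ j * moment ω (m / 2) :=
          h.moment_le_tail_add_of_le hC0 hdouble hlarge.le hm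
      _ ≤ C ^ j * tail ω (momentRadius m) +
          4 / (8 * C) * (2 * C ^ j * (C * tail ω (momentRadius m))) := by
          gcongr
          · exact (h.moment_pos _).le
          · exact (ih _ (by lia)).trans (by gcongr)
      _ = 2 * C ^ j * tail ω (momentRadius m) := by field_simp; ring

end IsUpperDoubling

/-! ### The Bergman kernel of a radial weight -/

section Polar

variable {E : Type*} [NormedAddCommGroup E] [NormedSpace ℝ E]

lemma integrableOn_smul_comp_polarCoord_symm {F : ℂ → E} (hF : Integrable F volume) :
    IntegrableOn (fun p : ℝ × ℝ => p.1 • F (Complex.polarCoord.symm p)) polarCoord.target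
      volume := by
  have hmeas : MeasurableSet polarCoord.target := measurableSet_Ioi.prod measurableSet_Ioo
  have hprod : Integrable (fun p : ℝ × ℝ => F (Complex.measurableEquivRealProd.symm p)) volume :=
    (Complex.volume_preserving_equiv_real_prod.symm.integrable_comp_emb
      Complex.measurableEquivRealProd.symm.measurableEmbedding).2 hF
  have hjac := (integrableOn_image_iff_integrableOn_abs_det_fderiv_smul volume hmeas
    (fun p _ => (hasFDerivAt_polarCoord_symm p).hasFDerivWithinAt) polarCoord.symm.injOn
    fun p : ℝ × ℝ => F (Complex.measurableEquivRealProd.symm p)).1 hprod.integrableOn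
  refine hjac.congr_fun (fun p hp => ?_) hmeas
  have hp1 : (0 : ℝ) < p.1 := hp.1
  simp only [det_fderivPolarCoordSymm, abs_of_pos hp1,
    ← Complex.measurableEquivRealProd_symm_polarCoord_symm_apply]

lemma integral_Ioo_neg_pi_pi_comp_circleMap (F : ℂ → E) (r : ℝ) :
    ∫ θ in Ioo (-Real.pi) Real.pi, F (circleMap 0 r θ) = (2 * Real.pi) • circleAverage F 0 r := by
  have hpi : 2 * Real.pi + -Real.pi = Real.pi := by ring
  rw [Real.circleAverage_eq_integral_add (-Real.pi),
    intervalIntegral.integral_comp_add_right fun θ => F (circleMap 0 r θ), zero_add, hpi,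
    smul_inv_smul₀ (by positivity), ← integral_Ioc_eq_integral_Ioo,
    intervalIntegral.integral_of_le (by linarith [Real.pi_pos])]

lemma integral_eq_integral_circleAverage {F : ℂ → E} (hF : Integrable F volume) :
    ∫ z, F z = ∫ r in Ioi (0 : ℝ), (r * (2 * Real.pi)) • circleAverage F 0 r := by
  have hcircle (r θ : ℝ) : Complex.polarCoord.symm (r, θ) = circleMap 0 r θ := by
    simp [circleMap, Complex.exp_mul_I]
  have hint := integrableOn_smul_comp_polarCoord_symm hF
  have htarget : polarCoord.target = Ioi (0 : ℝ) ×ˢ Ioo (-Real.pi) Real.pi := rfl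
  rw [htarget] at hint
  rw [← Complex.integral_comp_polarCoord_symm, htarget, Measure.volume_eq_prod,
    setIntegral_prod _ hint]
  simp_rw [hcircle, integral_smul, integral_Ioo_neg_pi_pi_comp_circleMap, smul_smul]

end Polar

lemma integral_areaMeasure {F : ℂ → ℂ} (hF : Integrable F areaMeasure) :
    ∫ ζ, F ζ ∂areaMeasure = ∫ r in Ioo (0 : ℝ) 1, ((2 * r : ℝ) : ℂ) * circleAverage F 0 r := by
  have hdisc : MeasurableSet disc := isOpen_disc.measurableSet
  have hF' : Integrable (disc.indicator F) volume := (integrable_indicator_iff hdisc).2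
    ((integrable_smul_measure (by simp [Real.pi_pos]) ENNReal.ofReal_ne_top).1 hF)
  have hradial : ∀ r ∈ Ioi (0 : ℝ), (r * (2 * Real.pi)) • circleAverage (disc.indicator F) 0 r =
      (Ioo (0 : ℝ) 1).indicator (fun r => (r * (2 * Real.pi)) • circleAverage F 0 r) r := by
    intro r hr
    have hsphere {z : ℂ} (hz : z ∈ Metric.sphere (0 : ℂ) |r|) : ‖z‖ = r := by
      rw [mem_sphere_zero_iff_norm.1 hz, abs_of_pos hr]
    by_cases hr1 : r < 1
    · rw [indicator_of_mem (show r ∈ Ioo (0 : ℝ) 1 from ⟨hr, hr1⟩),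
        Real.circleAverage_congr_sphere fun z hz =>
        indicator_of_mem (mem_disc.2 ((hsphere hz).trans_lt hr1)) F]
    · have hzero : EqOn (disc.indicator F) (fun _ => 0) (Metric.sphere 0 |r|) := fun z hz =>
        indicator_of_notMem (fun h => hr1 (hsphere hz ▸ mem_disc.1 h)) F
      rw [indicator_of_notMem (fun h => hr1 h.2), Real.circleAverage_congr_sphere hzero,
        Real.circleAverage_const, smul_zero]
  rw [areaMeasure, integral_smul_measure, ENNReal.toReal_ofReal (by positivity),
    ← integral_indicator hdisc, integral_eq_integral_circleAverage hF',
    setIntegral_congr_fun measurableSet_Ioi hradial, setIntegral_indicator measurableSet_Ioo,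
    inter_eq_self_of_subset_right Ioo_subset_Ioi_self, ← integral_smul]
  refine setIntegral_congr_fun measurableSet_Ioo fun r _ => ?_
  have := Real.pi_pos.ne'
  simp only [Complex.real_smul]
  push_cast
  field_simp

lemma ae_areaMeasure {P : ℂ → Prop} (h : ∀ z ∈ disc, P z) : ∀ᵐ z ∂areaMeasure, P z :=
  Measure.ae_smul_measure (ae_restrict_of_forall_mem isOpen_disc.measurableSet h) _

lemma aestronglyMeasurable_areaMeasure {f : ℂ → ℂ} (hf : ContinuousOn f disc) :
    AEStronglyMeasurable f areaMeasure :=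
  (hf.aestronglyMeasurable isOpen_disc.measurableSet).smul_measure _

lemma norm_conj_pow_le_one {z : ℂ} (hz : z ∈ disc) (n : ℕ) : ‖conj z ^ n‖ ≤ 1 := by
  simpa using pow_le_one₀ (norm_nonneg z) (mem_disc.1 hz).le

lemma integrable_conj_pow_mul {f : ℂ → ℂ} (hf : Integrable f areaMeasure) (n : ℕ) :
    Integrable (fun ζ => conj ζ ^ n * f ζ) areaMeasure :=
  hf.bdd_mul (c := 1) (Complex.continuous_conj.pow n).aestronglyMeasurable
    (ae_areaMeasure fun _ hz => norm_conj_pow_le_one hz n)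

lemma norm_mul_pow_le_norm (c : ℂ) {z : ℂ} (hz : z ∈ disc) (n : ℕ) : ‖c * z ^ n‖ ≤ ‖c‖ := by
  rw [norm_mul, norm_pow]
  exact mul_le_of_le_one_right (norm_nonneg c) (pow_le_one₀ (norm_nonneg z) (mem_disc.1 hz).le)

section RadialWeight

variable {ω : ℝ → ℝ} {a c : ℕ → ℂ} {f g : ℂ → ℂ}

lemma IsRadialWeight.integrable_areaMeasure (hω : IsRadialWeight ω) :
    Integrable (fun ζ : ℂ => ω ‖ζ‖) areaMeasure := by
  refine Integrable.smul_measure ?_ ENNReal.ofReal_ne_top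
  exact (integrableOn_fun_norm_addHaar (E := ℂ) volume (f := ω) (r := 1)).2
    (by simpa using (hω.integrableOn_pow_mul 1).mono_set Ioo_subset_Ico_self)

lemma IsRadialWeight.memBergman2_of_norm_le (hω : IsRadialWeight ω)
    (hf : DifferentiableOn ℂ f disc) {M : ℝ} (hM : ∀ z ∈ disc, ‖f z‖ ≤ M) : MemBergman2 ω f where
  analytic := hf
  integrable := by
    refine hω.integrable_areaMeasure.bdd_mul (c := M ^ 2)
      ((aestronglyMeasurable_areaMeasure hf.continuousOn).norm.pow 2)
      (ae_areaMeasure fun z hz => ?_)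
    rw [norm_pow, norm_norm]
    exact pow_le_pow_left₀ (norm_nonneg _) (hM z hz) 2

lemma MemBergman2.integrable_mul (hω : IsRadialWeight ω) (hf : MemBergman2 ω f) :
    Integrable (fun ζ => f ζ * (ω ‖ζ‖ : ℂ)) areaMeasure := by
  have hmeas : AEStronglyMeasurable (fun ζ => f ζ * (ω ‖ζ‖ : ℂ)) areaMeasure :=
    (aestronglyMeasurable_areaMeasure hf.analytic.continuousOn).mul
      (Complex.continuous_ofReal.comp_aestronglyMeasurable hω.integrable_areaMeasure.1)
  refine (hf.integrable.add hω.integrable_areaMeasure).mono' hmeas (ae_areaMeasure fun z hz => ?_)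
  have hωz := hω.nonneg ‖z‖ ⟨norm_nonneg z, mem_disc.1 hz⟩
  rw [norm_mul, Complex.norm_real, Real.norm_of_nonneg hωz, Pi.add_apply, ← add_one_mul]
  gcongr
  nlinarith [sq_nonneg (‖f z‖ - 1), norm_nonneg (f z)]

lemma HasPowerSeriesOnDisc.integral_conj_pow_mul (ha : HasPowerSeriesOnDisc a f)
    (hf : Integrable (fun ζ => f ζ * (ω ‖ζ‖ : ℂ)) areaMeasure) (n : ℕ) :
    ∫ ζ, conj ζ ^ n * (f ζ * (ω ‖ζ‖ : ℂ)) ∂areaMeasure = 2 * moment ω (2 * n + 1) * a n := by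
  have hradial : ∀ r ∈ Ioo (0 : ℝ) 1, ((2 * r : ℝ) : ℂ) *
      circleAverage (fun ζ => conj ζ ^ n * (f ζ * (ω ‖ζ‖ : ℂ))) 0 r =
      (2 * a n) * ((r ^ (2 * n + 1) * ω r : ℝ) : ℂ) := by
    intro r hr
    have hcongr : circleAverage (fun ζ => conj ζ ^ n * (f ζ * (ω ‖ζ‖ : ℂ))) 0 r =
        circleAverage (fun ζ => (ω r : ℂ) • (f ζ * conj ζ ^ n)) 0 r := by
      refine Real.circleAverage_congr_sphere fun z hz => ?_
      rw [mem_sphere_zero_iff_norm, abs_of_pos hr.1] at hz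
      simp only [hz, smul_eq_mul]
      ring
    rw [hcongr, Real.circleAverage_fun_smul,
      (ha.onCircle (Ioo_subset_Ico_self hr)).circleAverage_mul_conj_pow n, smul_eq_mul]
    push_cast
    ring
  rw [integral_areaMeasure (integrable_conj_pow_mul hf n),
    setIntegral_congr_fun measurableSet_Ioo hradial, integral_const_mul, integral_complex_ofReal,
    moment, integral_Ico_eq_integral_Ioo]
  ring

lemma HasPowerSeriesOnDisc.hasSum_integral_mul_conj (ha : HasPowerSeriesOnDisc a f)
    (hf : Integrable (fun ζ => f ζ * (ω ‖ζ‖ : ℂ)) areaMeasure) (hg : HasPowerSeriesOnDisc c g)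
    (hc : Summable fun n => ‖c n‖) :
    HasSum (fun n => conj (c n) * (2 * moment ω (2 * n + 1) * a n))
      (∫ ζ, f ζ * conj (g ζ) * (ω ‖ζ‖ : ℂ) ∂areaMeasure) := by
  have hterm (n : ℕ) : Integrable (fun ζ => conj (c n) * (conj ζ ^ n * (f ζ * (ω ‖ζ‖ : ℂ))))
      areaMeasure := (integrable_conj_pow_mul hf n).const_mul _
  have hnorm : Summable fun n =>
      ∫ ζ, ‖conj (c n) * (conj ζ ^ n * (f ζ * (ω ‖ζ‖ : ℂ)))‖ ∂areaMeasure := by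
    refine Summable.of_nonneg_of_le (fun n => integral_nonneg fun ζ => norm_nonneg _)
      (fun n => ?_) (hc.mul_right (∫ ζ, ‖f ζ * (ω ‖ζ‖ : ℂ)‖ ∂areaMeasure))
    rw [← integral_const_mul]
    refine integral_mono_ae (hterm n).norm (hf.norm.const_mul _) (ae_areaMeasure fun z hz => ?_)
    beta_reduce
    rw [norm_mul, Complex.norm_conj, norm_mul (conj z ^ n)]
    exact mul_le_mul_of_nonneg_left
      (mul_le_of_le_one_left (norm_nonneg _) (norm_conj_pow_le_one hz n)) (norm_nonneg _)
  have hsum := hasSum_integral_of_summable_integral_norm hterm hnorm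
  simp_rw [integral_const_mul, ha.integral_conj_pow_mul hf] at hsum
  have heq : ∫ ζ, f ζ * conj (g ζ) * (ω ‖ζ‖ : ℂ) ∂areaMeasure =
      ∫ ζ, ∑' n, conj (c n) * (conj ζ ^ n * (f ζ * (ω ‖ζ‖ : ℂ))) ∂areaMeasure := by
    refine integral_congr_ae (ae_areaMeasure fun z hz => ?_)
    beta_reduce
    rw [← (hg z hz).tsum_eq, Complex.conj_tsum, mul_right_comm, ← tsum_mul_left]
    refine tsum_congr fun n => ?_
    rw [map_mul, map_pow]
    ring
  rwa [heq]

/-- The Taylor coefficients of the Bergman kernel: `B^ω_t(z) = ∑ kernelCoeff ω n (t z)ⁿ`. -/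
def kernelCoeff (ω : ℝ → ℝ) (n : ℕ) : ℝ := 1 / (2 * moment ω (2 * n + 1))

namespace IsRadialWeight

lemma kernelCoeff_pos (hω : IsRadialWeight ω) (n : ℕ) : 0 < kernelCoeff ω n :=
  one_div_pos.2 (mul_pos two_pos (hω.moment_pos _))

lemma kernelCoeff_mul_moment (hω : IsRadialWeight ω) (n : ℕ) :
    kernelCoeff ω n * (2 * moment ω (2 * n + 1)) = 1 :=
  one_div_mul_cancel (mul_pos two_pos (hω.moment_pos _)).ne'

lemma summable_kernelCoeff (hω : IsRadialWeight ω) {y : ℝ} (hy : y ∈ Ico (0 : ℝ) 1) :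
    Summable fun n => kernelCoeff ω n * y ^ n := by
  have hy0 := hy.1
  obtain ⟨u, hyu, hu1⟩ := exists_between ((Real.sqrt_lt' one_pos).2 (by simpa using hy.2))
  have hu0 : 0 < u := (Real.sqrt_nonneg y).trans_lt hyu
  have hu : u ∈ Ico (0 : ℝ) 1 := ⟨hu0.le, hu1⟩
  have htail := hω.tail_pos u hu
  have hgeom : Summable fun n : ℕ => 1 / (2 * (u * tail ω u)) * (y / u ^ 2) ^ n :=
    (summable_geometric_of_lt_one (by positivity)
      ((div_lt_one (by positivity)).2 ((Real.sqrt_lt' hu0).1 hyu))).mul_left _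
  refine hgeom.of_nonneg_of_le
    (fun n => mul_nonneg (hω.kernelCoeff_pos n).le (pow_nonneg hy0 n)) fun n => ?_
  have hcoeff : kernelCoeff ω n ≤ 1 / (2 * (u ^ (2 * n + 1) * tail ω u)) :=
    one_div_le_one_div_of_le (by positivity)
      (mul_le_mul_of_nonneg_left (hω.pow_mul_tail_le_moment hu _) two_pos.le)
  calc kernelCoeff ω n * y ^ n ≤ 1 / (2 * (u ^ (2 * n + 1) * tail ω u)) * y ^ n := by gcongr
    _ = 1 / (2 * (u * tail ω u)) * (y / u ^ 2) ^ n := by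
      rw [div_pow y, ← pow_mul, pow_succ u]
      field_simp

lemma exists_isReproducingKernelAt (hω : IsRadialWeight ω) {t : ℝ} (ht : t ∈ Ico (0 : ℝ) 1) :
    ∃ g, IsReproducingKernelAt ω t g := by
  set c : ℕ → ℂ := fun n => ((kernelCoeff ω n * t ^ n : ℝ) : ℂ) with hc_def
  have hc : Summable fun n => ‖c n‖ := by
    simpa only [hc_def, Complex.norm_real] using (hω.summable_kernelCoeff ht).norm
  have hg : HasPowerSeriesOnDisc c fun z => ∑' n, c n * z ^ n := fun z hz =>
    (hc.of_norm_bounded fun n => norm_mul_pow_le_norm (c n) hz n).hasSum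
  refine ⟨_, hω.memBergman2_of_norm_le hg.differentiableOn fun z hz =>
    tsum_of_norm_bounded hc.hasSum fun n => norm_mul_pow_le_norm (c n) hz n, fun f hf => ?_⟩
  obtain ⟨a, ha⟩ := exists_hasPowerSeriesOnDisc hf.analytic
  refine (ha t (ofReal_mem_disc ht)).unique ?_
  convert ha.hasSum_integral_mul_conj (hf.integrable_mul hω) hg hc using 2 with n
  have hcoeff : (kernelCoeff ω n : ℂ) * (2 * moment ω (2 * n + 1)) = 1 := by
    exact_mod_cast hω.kernelCoeff_mul_moment n
  rw [hc_def, Complex.conj_ofReal]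
  push_cast
  linear_combination (-a n * (t : ℂ) ^ n) * hcoeff

lemma isReproducingKernelAt_bergmanKernel (hω : IsRadialWeight ω) {t : ℝ}
    (ht : t ∈ Ico (0 : ℝ) 1) : IsReproducingKernelAt ω t (bergmanKernel ω t) := by
  rw [bergmanKernel, dif_pos (hω.exists_isReproducingKernelAt ht)]
  exact (hω.exists_isReproducingKernelAt ht).choose_spec

lemma hasPowerSeriesOnDisc_bergmanKernel (hω : IsRadialWeight ω) {t : ℝ}
    (ht : t ∈ Ico (0 : ℝ) 1) :
    HasPowerSeriesOnDisc (fun n => kernelCoeff ω n * (t : ℂ) ^ n) (bergmanKernel ω t) := by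
  obtain ⟨hmem, hrep⟩ := hω.isReproducingKernelAt_bergmanKernel ht
  obtain ⟨b, hb⟩ := exists_hasPowerSeriesOnDisc hmem.analytic
  suffices h : (fun n => kernelCoeff ω n * (t : ℂ) ^ n) = b by rwa [h]
  ext n
  -- Reproducing the monomial `zⁿ` and conjugating reads off the `n`-th coefficient.
  have hpow : MemBergman2 ω fun z => z ^ n :=
    hω.memBergman2_of_norm_le (by fun_prop) fun z hz => by
      simpa using norm_mul_pow_le_norm 1 hz n
  have hconj := congrArg conj (hrep _ hpow)
  rw [← integral_conj] at hconj
  have hmoment : (t : ℂ) ^ n = 2 * moment ω (2 * n + 1) * b n := by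
    rw [← hb.integral_conj_pow_mul (hmem.integrable_mul hω) n]
    simpa [mul_assoc] using hconj
  have hcoeff : (kernelCoeff ω n : ℂ) * (2 * moment ω (2 * n + 1)) = 1 := by
    exact_mod_cast hω.kernelCoeff_mul_moment n
  rw [hmoment, ← mul_assoc, hcoeff, one_mul]

end IsRadialWeight

end RadialWeight

/-! ### Estimates for doubling weights -/

/-- The Taylor coefficients of the averaged kernel: `K^ω_t(z) = ∑ avgCoeff ω n (t z)ⁿ`. -/
def avgCoeff (ω : ℝ → ℝ) (n : ℕ) : ℝ := kernelCoeff ω n / (n + 1)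

/-- The Taylor coefficients of `(1 - z) ∑ kernelCoeff ω n zⁿ`. -/
def kernelDiff (ω : ℝ → ℝ) : ℕ → ℝ
  | 0 => kernelCoeff ω 0
  | n + 1 => kernelCoeff ω (n + 1) - kernelCoeff ω n

lemma mul_integral_inv_tail (ω : ℝ → ℝ) (t : ℝ) :
    t * ∫ s in (0 : ℝ)..1, 1 / tail ω (t * s) = tailWeight ω t - 1 := by
  rw [intervalIntegral.mul_integral_comp_mul_left (f := fun s => 1 / tail ω s)]
  simp [tailWeight]

lemma mul_mem_Ico {s t : ℝ} (ht : t ∈ Ico (0 : ℝ) 1) (hs : s ∈ Icc (0 : ℝ) 1) :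
    t * s ∈ Ico (0 : ℝ) 1 :=
  ⟨mul_nonneg ht.1 hs.1, (mul_le_of_le_one_right ht.1 hs.2).trans_lt ht.2⟩

namespace IsRadialWeight

variable {ω : ℝ → ℝ}

lemma kernelCoeff_monotone (hω : IsRadialWeight ω) : Monotone (kernelCoeff ω) := fun m n hmn =>
  one_div_le_one_div_of_le (mul_pos two_pos (hω.moment_pos _))
    (mul_le_mul_of_nonneg_left (hω.moment_antitone (by lia)) two_pos.le)

lemma avgCoeff_nonneg (hω : IsRadialWeight ω) (n : ℕ) : 0 ≤ avgCoeff ω n :=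
  div_nonneg (hω.kernelCoeff_pos n).le (by positivity)

lemma avgCoeff_le (hω : IsRadialWeight ω) (n : ℕ) : avgCoeff ω n ≤ kernelCoeff ω n :=
  div_le_self (hω.kernelCoeff_pos n).le (by simp)

lemma summable_avgCoeff (hω : IsRadialWeight ω) {y : ℝ} (hy : y ∈ Ico (0 : ℝ) 1) :
    Summable fun n => avgCoeff ω n * y ^ n :=
  (hω.summable_kernelCoeff hy).of_nonneg_of_le
    (fun n => mul_nonneg (hω.avgCoeff_nonneg n) (pow_nonneg hy.1 n))
    fun n => mul_le_mul_of_nonneg_right (hω.avgCoeff_le n) (pow_nonneg hy.1 n)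

lemma kernelCoeff_mul_pow_le (hω : IsRadialWeight ω) {s : ℝ} (hs : s ∈ Ico (0 : ℝ) 1) (n : ℕ) :
    kernelCoeff ω n * s ^ n ≤ 1 / tail ω ((1 + s) / 2) := by
  have hmid := one_add_div_two_mem hs
  have hs0 := hs.1
  have hsq : s ≤ ((1 + s) / 2) ^ 2 := by linarith [sq_nonneg (1 - s)]
  have hpow : s ^ n ≤ 2 * ((1 + s) / 2) ^ (2 * n + 1) := by
    calc s ^ n ≤ (((1 + s) / 2) ^ 2) ^ n := by gcongr
      _ ≤ (((1 + s) / 2) ^ 2) ^ n * (1 + s) := le_mul_of_one_le_right (by positivity) (by linarith)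
      _ = 2 * ((1 + s) / 2) ^ (2 * n + 1) := by rw [← pow_mul, pow_succ]; ring
  rw [le_div_iff₀ (hω.tail_pos _ hmid), mul_assoc]
  refine le_of_le_of_eq ?_ (hω.kernelCoeff_mul_moment n)
  refine mul_le_mul_of_nonneg_left ?_ (hω.kernelCoeff_pos n).le
  calc s ^ n * tail ω ((1 + s) / 2)
      ≤ 2 * ((1 + s) / 2) ^ (2 * n + 1) * tail ω ((1 + s) / 2) :=
        mul_le_mul_of_nonneg_right hpow (hω.tail_pos _ hmid).le
    _ = 2 * (((1 + s) / 2) ^ (2 * n + 1) * tail ω ((1 + s) / 2)) := mul_assoc _ _ _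
    _ ≤ 2 * moment ω (2 * n + 1) :=
        mul_le_mul_of_nonneg_left (hω.pow_mul_tail_le_moment hmid _) two_pos.le

-- The terms of index `m ≤ n ≤ 2 m` already suffice, since `y ^ n ≥ 1 / 16` for these.
lemma kernelCoeff_le_tsum_avgCoeff (hω : IsRadialWeight ω) {y : ℝ} (hy : y ∈ Ico (0 : ℝ) 1)
    {m : ℕ} (hm : momentRadius m ≤ y) :
    kernelCoeff ω m ≤ 32 * ∑' n, avgCoeff ω n * y ^ n := by
  have hpow : 1 / 4 ≤ y ^ m :=
    (one_div_four_le_momentRadius_pow m).trans (pow_le_pow_left₀ (momentRadius_mem m).1 hm m)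
  have hterm : ∀ n ∈ Finset.Icc m (2 * m),
      kernelCoeff ω m / (2 * (m + 1)) * (1 / 16) ≤ avgCoeff ω n * y ^ n := by
    intro n hn
    obtain ⟨hmn, hnm⟩ := Finset.mem_Icc.1 hn
    have hcoeff : kernelCoeff ω m / (2 * (m + 1)) ≤ avgCoeff ω n :=
      div_le_div₀ (hω.kernelCoeff_pos n).le (hω.kernelCoeff_monotone hmn) (by positivity)
        (by exact_mod_cast (by lia : n + 1 ≤ 2 * (m + 1)))
    have hpow_n : 1 / 16 ≤ y ^ n :=
      calc (1 / 16 : ℝ) = 1 / 4 * (1 / 4) := by norm_num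
        _ ≤ y ^ m * y ^ m := by gcongr
        _ = y ^ (2 * m) := by rw [two_mul, pow_add]
        _ ≤ y ^ n := pow_le_pow_of_le_one hy.1 hy.2.le hnm
    exact mul_le_mul hcoeff hpow_n (by norm_num) (hω.avgCoeff_nonneg n)
  have hcard := Finset.card_nsmul_le_sum _ _ _ hterm
  have hsum := (hω.summable_avgCoeff hy).sum_le_tsum (Finset.Icc m (2 * m)) fun n _ =>
    mul_nonneg (hω.avgCoeff_nonneg n) (pow_nonneg hy.1 n)
  rw [Nat.card_Icc, show 2 * m + 1 - m = m + 1 by lia, nsmul_eq_mul, Nat.cast_add_one] at hcard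
  calc kernelCoeff ω m
      = 32 * (((m : ℝ) + 1) * (kernelCoeff ω m / (2 * (m + 1)) * (1 / 16))) := by
        field_simp
        ring
    _ ≤ 32 * ∑' n, avgCoeff ω n * y ^ n := by gcongr; exact hcard.trans hsum

lemma inv_tail_mul_nonneg (hω : IsRadialWeight ω) {s t : ℝ} (ht : t ∈ Ico (0 : ℝ) 1)
    (hs : s ∈ Icc (0 : ℝ) 1) : 0 ≤ 1 / tail ω (t * s) :=
  one_div_nonneg.2 (hω.tail_pos _ (mul_mem_Ico ht hs)).le

lemma intervalIntegrable_inv_tail_mul (hω : IsRadialWeight ω) {t : ℝ} (ht : t ∈ Ico (0 : ℝ) 1) :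
    IntervalIntegrable (fun s => 1 / tail ω (t * s)) volume 0 1 := by
  refine ContinuousOn.intervalIntegrable ?_
  rw [uIcc_of_le zero_le_one]
  exact hω.continuousOn_inv_tail.comp (by fun_prop) fun s hs => mul_mem_Ico ht hs

lemma exists_integral_inv_tail_mul_le (hω : IsRadialWeight ω) :
    ∃ K : ℝ, 0 < K ∧ ∀ t ∈ Ico (0 : ℝ) 1,
      ∫ s in (0 : ℝ)..1, 1 / tail ω (t * s) ≤ K * tailWeight ω t := by
  have hhalf := hω.tail_pos (1 / 2) ⟨by norm_num, by norm_num⟩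
  refine ⟨2 + 1 / tail ω (1 / 2), by positivity, fun t ht => ?_⟩
  have hW := hω.one_le_tailWeight ht
  have hW_half : 1 / tail ω (1 / 2) ≤ 1 / tail ω (1 / 2) * tailWeight ω t :=
    le_mul_of_one_le_right (by positivity) hW
  rcases le_or_gt (1 / 2) t with hlarge | hsmall
  · have hnonneg : 0 ≤ ∫ s in (0 : ℝ)..1, 1 / tail ω (t * s) :=
      intervalIntegral.integral_nonneg zero_le_one fun s hs => hω.inv_tail_mul_nonneg ht hs
    have hhalf' : 0 < 1 / tail ω (1 / 2) := by positivity
    linarith [mul_le_mul_of_nonneg_right hlarge hnonneg, mul_integral_inv_tail ω t]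
  · have hle : ∫ s in (0 : ℝ)..1, 1 / tail ω (t * s) ≤ ∫ _ in (0 : ℝ)..1, 1 / tail ω (1 / 2) := by
      refine intervalIntegral.integral_mono_on zero_le_one
        (hω.intervalIntegrable_inv_tail_mul ht) intervalIntegrable_const fun s hs => ?_
      exact one_div_le_one_div_of_le hhalf (hω.tail_anti (mul_nonneg ht.1 hs.1)
        ((mul_le_of_le_one_right ht.1 hs.2).trans hsmall.le) (by norm_num))
    simp only [intervalIntegral.integral_const, sub_zero, one_smul] at hle
    linarith

lemma tailWeight_le_integral_inv_tail_mul (hω : IsRadialWeight ω) {t : ℝ}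
    (ht : t ∈ Ico (0 : ℝ) 1) :
    tailWeight ω t ≤ (tail ω 0 + 1) * ∫ s in (0 : ℝ)..1, 1 / tail ω (t * s) := by
  have h0 := hω.tail_pos 0 (left_mem_Ico.2 one_pos)
  have hle : ∫ _ in (0 : ℝ)..1, 1 / tail ω 0 ≤ ∫ s in (0 : ℝ)..1, 1 / tail ω (t * s) :=
    intervalIntegral.integral_mono_on zero_le_one intervalIntegrable_const
      (hω.intervalIntegrable_inv_tail_mul ht) fun s hs =>
        have hts := mul_mem_Ico ht hs
        one_div_le_one_div_of_le (hω.tail_pos _ hts) (hω.tail_anti le_rfl hts.1 hts.2.le)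
  simp only [intervalIntegral.integral_const, sub_zero, one_smul] at hle
  have hone := (div_le_iff₀' h0).1 hle
  have hnonneg := (one_div_pos.2 h0).le.trans hle
  linarith [mul_integral_inv_tail ω t, mul_le_mul_of_nonneg_right ht.2.le hnonneg]

end IsRadialWeight

namespace IsUpperDoubling

variable {ω : ℝ → ℝ}

lemma exists_one_sub_le_tailWeight_mul_tail (hω : IsUpperDoubling ω) :
    ∃ D : ℝ, 0 < D ∧ ∀ a ∈ Ico (0 : ℝ) 1, 1 - a ≤ D * (tailWeight ω a * tail ω a) := by
  obtain ⟨C, hC, hdouble⟩ := hω.doubling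
  have h := hω.radialWeight
  have hhalf := h.tail_pos (1 / 2) ⟨by norm_num, by norm_num⟩
  refine ⟨C + 1 / tail ω (1 / 2), by positivity, fun a ha => ?_⟩
  have hta := h.tail_pos a ha
  have hW := h.one_le_tailWeight ha
  have : 0 < tailWeight ω a * tail ω a := mul_pos (by linarith) hta
  have hinv : 0 < 1 / tail ω (1 / 2) * (tailWeight ω a * tail ω a) := by positivity
  have hCWt : 0 ≤ C * (tailWeight ω a * tail ω a) := by positivity
  rw [add_mul]
  rcases le_or_gt (1 / 2) a with hlarge | hsmall
  · have hr : 2 * a - 1 ∈ Ico (0 : ℝ) 1 := by constructor <;> linarith [ha.2]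
    have htr := h.tail_pos _ hr
    have hdouble_r := hdouble _ hr
    rw [add_sub_cancel, mul_div_cancel_left₀ a two_ne_zero] at hdouble_r
    have hW_sub : (1 - a) / tail ω (2 * a - 1) ≤ tailWeight ω a := by
      have hint := h.div_tail_le_integral hr.1 (by linarith [ha.2] : 2 * a - 1 ≤ a) ha.2
      rw [← h.tailWeight_sub hr ha, show a - (2 * a - 1) = 1 - a by ring] at hint
      linarith [h.one_le_tailWeight hr]
    have hWC := mul_le_mul_of_nonneg_left hdouble_r (zero_le_one.trans hW)
    linarith [(div_le_iff₀ htr).1 hW_sub]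
  · have hanti := h.tail_anti ha.1 hsmall.le (by norm_num)
    have hone : 1 ≤ 1 / tail ω (1 / 2) * (tailWeight ω a * tail ω a) := by
      rw [one_div_mul_eq_div, one_le_div hhalf]
      exact hanti.trans (le_mul_of_one_le_left hta.le hW)
    linarith [ha.1]

lemma exists_tailWeight_le (hω : IsUpperDoubling ω) :
    ∃ E : ℝ, 0 < E ∧ ∀ a ∈ Ico (0 : ℝ) 1, tailWeight ω ((1 + a) / 2) ≤ E * tailWeight ω a := by
  obtain ⟨D, hD, hsub⟩ := hω.exists_one_sub_le_tailWeight_mul_tail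
  obtain ⟨C, hC, hdouble⟩ := hω.doubling
  have h := hω.radialWeight
  refine ⟨1 + C * D, by positivity, fun a ha => ?_⟩
  have hmid := one_add_div_two_mem ha
  have hle : a ≤ (1 + a) / 2 := by linarith [ha.2]
  have hW := h.one_le_tailWeight ha
  have hdiv : ((1 + a) / 2 - a) / tail ω ((1 + a) / 2) ≤ C * D * tailWeight ω a := by
    rw [div_le_iff₀ (h.tail_pos _ hmid)]
    calc (1 + a) / 2 - a ≤ 1 - a := by linarith [ha.2]
      _ ≤ D * (tailWeight ω a * tail ω a) := hsub a ha
      _ ≤ D * (tailWeight ω a * (C * tail ω ((1 + a) / 2))) := by gcongr; exact hdouble a ha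
      _ = C * D * tailWeight ω a * tail ω ((1 + a) / 2) := by ring
  linarith [h.tailWeight_sub ha hmid, h.integral_le_div_tail ha.1 hle hmid.2]

lemma exists_kernelCoeff_mul_pow_le (hω : IsUpperDoubling ω) :
    ∃ D : ℝ, 0 < D ∧ ∀ s ∈ Ico (0 : ℝ) 1, ∀ n : ℕ,
      kernelCoeff ω n * s ^ n ≤ D * tailWeight ω s / (1 - s) := by
  obtain ⟨D, hD, hsub⟩ := hω.exists_one_sub_le_tailWeight_mul_tail
  obtain ⟨E, hE, hW⟩ := hω.exists_tailWeight_le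
  refine ⟨2 * D * E, by positivity, fun s hs n => ?_⟩
  have hmid := one_add_div_two_mem hs
  have htail := hω.radialWeight.tail_pos _ hmid
  refine (hω.radialWeight.kernelCoeff_mul_pow_le hs n).trans ?_
  rw [div_le_div_iff₀ htail (sub_pos.2 hs.2), one_mul]
  calc 1 - s = 2 * (1 - (1 + s) / 2) := by ring
    _ ≤ 2 * (D * (tailWeight ω ((1 + s) / 2) * tail ω ((1 + s) / 2))) := by
        gcongr; exact hsub _ hmid
    _ ≤ 2 * (D * (E * tailWeight ω s * tail ω ((1 + s) / 2))) := by gcongr; exact hW s hs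
    _ = 2 * D * E * tailWeight ω s * tail ω ((1 + s) / 2) := by ring

lemma exists_avgCoeff_mul_pow_le (hω : IsUpperDoubling ω) :
    ∃ D : ℝ, 0 < D ∧ ∀ s ∈ Ico (0 : ℝ) 1, ∀ n : ℕ, avgCoeff ω n * s ^ n ≤ D * tailWeight ω s := by
  obtain ⟨D, hD, hcoeff⟩ := hω.exists_kernelCoeff_mul_pow_le
  have h := hω.radialWeight
  have hfar : ∀ s ∈ Ico (0 : ℝ) 1, ∀ n : ℕ, s ≤ momentRadius n →
      avgCoeff ω n * s ^ n ≤ D * tailWeight ω s := by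
    intro s hs n hsn
    have hW : 0 ≤ D * tailWeight ω s :=
      mul_nonneg hD.le (zero_le_one.trans (h.one_le_tailWeight hs))
    have hone : 1 ≤ (1 - s) * (n + 1) := by
      rw [← div_le_iff₀ (by positivity)]
      linarith [one_sub_momentRadius n]
    rw [avgCoeff, div_mul_eq_mul_div, div_le_iff₀ (by positivity)]
    calc kernelCoeff ω n * s ^ n ≤ D * tailWeight ω s / (1 - s) := hcoeff s hs n
      _ ≤ D * tailWeight ω s * (n + 1) := by
          rw [div_le_iff₀ (sub_pos.2 hs.2), mul_assoc, mul_comm ((n : ℝ) + 1)]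
          exact le_mul_of_one_le_right hW hone
  refine ⟨4 * D, by positivity, fun s hs n => ?_⟩
  rcases le_total s (momentRadius n) with hsn | hns
  · linarith [hfar s hs n hsn, mul_pos hD (one_pos.trans_le (h.one_le_tailWeight hs))]
  -- Beyond `momentRadius n` the power `s ^ n` is comparable to its value at `momentRadius n`.
  · have hpow : s ^ n ≤ 4 * momentRadius n ^ n := by
      linarith [pow_le_one₀ (n := n) hs.1 hs.2.le, one_div_four_le_momentRadius_pow n]
    calc avgCoeff ω n * s ^ n ≤ avgCoeff ω n * (4 * momentRadius n ^ n) :=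
          mul_le_mul_of_nonneg_left hpow (h.avgCoeff_nonneg n)
      _ = 4 * (avgCoeff ω n * momentRadius n ^ n) := by ring
      _ ≤ 4 * (D * tailWeight ω (momentRadius n)) := by
          gcongr ?_ * ?_
          exact hfar _ (momentRadius_mem n) n le_rfl
      _ ≤ 4 * D * tailWeight ω s := by
          rw [mul_assoc]
          gcongr
          exact h.tailWeight_mono (momentRadius_mem n).1 hns hs.2

lemma exists_moment_le_moment (hω : IsUpperDoubling ω) :
    ∃ K : ℝ, 0 < K ∧ ∀ n : ℕ, moment ω n ≤ K * moment ω (2 * n + 1) := by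
  obtain ⟨K, hK, hmoment⟩ := hω.exists_moment_le_tail
  obtain ⟨L, hL, htail⟩ := hω.exists_tail_momentRadius_le 1
  refine ⟨K * L * 4, by positivity, fun n => ?_⟩
  have hradius : tail ω (momentRadius n) ≤ L * tail ω (momentRadius (2 * n + 1)) :=
    htail (momentRadius_mem n) (by
      rw [one_sub_momentRadius]
      push_cast
      field_simp
      linarith)
  calc moment ω n ≤ K * tail ω (momentRadius n) := hmoment n
    _ ≤ K * (L * (4 * moment ω (2 * n + 1))) := by
        gcongr
        exact hradius.trans (by gcongr; exact hω.radialWeight.tail_le_moment _)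
    _ = K * L * 4 * moment ω (2 * n + 1) := by ring

lemma exists_kernelCoeff_succ_sub_le (hω : IsUpperDoubling ω) :
    ∃ K : ℝ, 0 < K ∧ ∀ n : ℕ,
      kernelCoeff ω (n + 1) - kernelCoeff ω n ≤ K * (kernelCoeff ω (n + 1) / (n + 1)) := by
  obtain ⟨K, hK, hmoment⟩ := hω.exists_moment_le_moment
  refine ⟨2 * K, by positivity, fun n => ?_⟩
  have hm := hω.radialWeight.moment_pos (2 * n + 1)
  have hm' := hω.radialWeight.moment_pos (2 * n + 3)
  have hsub : moment ω (2 * n + 1) - moment ω (2 * n + 3) ≤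
      2 / (n + 1 : ℕ) * (K * moment ω (2 * n + 1)) :=
    (hω.radialWeight.moment_sub_le n).trans (by gcongr; exact hmoment n)
  calc kernelCoeff ω (n + 1) - kernelCoeff ω n
      = (moment ω (2 * n + 1) - moment ω (2 * n + 3)) /
          (2 * moment ω (2 * n + 1) * moment ω (2 * n + 3)) := by
        simp only [kernelCoeff, mul_add_one, add_assoc, Nat.reduceAdd]
        field_simp
    _ ≤ 2 / (n + 1 : ℕ) * (K * moment ω (2 * n + 1)) /
          (2 * moment ω (2 * n + 1) * moment ω (2 * n + 3)) := by gcongr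
    _ = 2 * K * (kernelCoeff ω (n + 1) / (n + 1)) := by
        simp only [kernelCoeff, mul_add_one, add_assoc, Nat.reduceAdd, Nat.cast_add_one]
        field_simp

lemma exists_abs_kernelDiff_le (hω : IsUpperDoubling ω) :
    ∃ D : ℝ, 0 < D ∧ ∀ n : ℕ, |kernelDiff ω n| ≤ D * avgCoeff ω n := by
  obtain ⟨K, hK, hsub⟩ := hω.exists_kernelCoeff_succ_sub_le
  have h := hω.radialWeight
  refine ⟨1 + 2 * K, by positivity, fun n => ?_⟩
  cases n with
  | zero =>
    have hpos := h.kernelCoeff_pos 0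
    rw [kernelDiff, abs_of_pos hpos, avgCoeff, Nat.cast_zero, zero_add, div_one]
    exact le_mul_of_one_le_left hpos.le (by linarith)
  | succ n =>
    have hpos := h.kernelCoeff_pos (n + 1)
    rw [kernelDiff, abs_of_nonneg (sub_nonneg.2 (h.kernelCoeff_monotone n.le_succ))]
    calc kernelCoeff ω (n + 1) - kernelCoeff ω n
        ≤ K * (kernelCoeff ω (n + 1) / (n + 1)) := hsub n
      _ ≤ K * (2 * avgCoeff ω (n + 1)) := by
          rw [avgCoeff, Nat.cast_add_one]
          refine mul_le_mul_of_nonneg_left ?_ hK.le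
          rw [← mul_div_assoc]
          rw [div_le_div_iff₀ (by positivity) (by positivity)]
          nlinarith [mul_nonneg hpos.le n.cast_nonneg]
      _ ≤ (1 + 2 * K) * avgCoeff ω (n + 1) := by linarith [h.avgCoeff_nonneg (n + 1)]

lemma exists_abs_kernelDiff_mul_pow_le (hω : IsUpperDoubling ω) :
    ∃ D : ℝ, 0 < D ∧ ∀ s ∈ Ico (0 : ℝ) 1, ∀ n : ℕ,
      |kernelDiff ω n| * s ^ n ≤ D * tailWeight ω s * ((1 + s) / 2) ^ n := by
  obtain ⟨D, hD, hdiff⟩ := hω.exists_abs_kernelDiff_le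
  obtain ⟨B, hB, havg⟩ := hω.exists_avgCoeff_mul_pow_le
  obtain ⟨E, hE, hW⟩ := hω.exists_tailWeight_le
  refine ⟨D * (B * E), by positivity, fun s hs n => ?_⟩
  have hmid := one_add_div_two_mem hs
  have hs0 := hs.1
  have hsq : s ≤ (1 + s) / 2 * ((1 + s) / 2) := by linarith [sq_nonneg (1 - s)]
  calc |kernelDiff ω n| * s ^ n
      ≤ D * avgCoeff ω n * ((1 + s) / 2 * ((1 + s) / 2)) ^ n := by
        gcongr
        exacts [(abs_nonneg _).trans (hdiff n), hdiff n]
    _ = D * (avgCoeff ω n * ((1 + s) / 2) ^ n) * ((1 + s) / 2) ^ n := by rw [mul_pow]; ring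
    _ ≤ D * (B * (E * tailWeight ω s)) * ((1 + s) / 2) ^ n := by
        have := hmid.1
        gcongr ?_ * ?_ * ?_
        exact (havg _ hmid n).trans (by gcongr; exact hW s hs)
    _ = D * (B * E) * tailWeight ω s * ((1 + s) / 2) ^ n := by ring

lemma exists_inv_tail_le_tsum_avgCoeff (hω : IsUpperDoubling ω) :
    ∃ K : ℝ, 0 < K ∧ ∀ y ∈ Ico (0 : ℝ) 1, 1 / tail ω y ≤ K * ∑' n, avgCoeff ω n * y ^ n := by
  obtain ⟨K, hK, hmoment⟩ := hω.exists_moment_le_tail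
  have h := hω.radialWeight
  refine ⟨64 * K, by positivity, fun y hy => ?_⟩
  obtain ⟨m, hmy, hym⟩ := exists_momentRadius_le_le hy
  have hm := h.moment_pos (2 * m + 1)
  have hle : moment ω (2 * m + 1) ≤ K * tail ω y :=
    (hmoment _).trans <| mul_le_mul_of_nonneg_left (h.tail_anti hy.1
      (hym.trans (momentRadius_mono (by lia))) (momentRadius_mem _).2.le) hK.le
  calc 1 / tail ω y ≤ 2 * K * kernelCoeff ω m := by
        rw [kernelCoeff, mul_one_div, mul_div_mul_left _ _ two_ne_zero,
          div_le_div_iff₀ (h.tail_pos y hy) hm, one_mul]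
        exact hle
    _ ≤ 2 * K * (32 * ∑' n, avgCoeff ω n * y ^ n) := by
        gcongr; exact h.kernelCoeff_le_tsum_avgCoeff hy hmy
    _ = 64 * K * ∑' n, avgCoeff ω n * y ^ n := by ring

end IsUpperDoubling

/-! ### The averaged kernel -/

/-- The function with `B^ω_t(z) = kernelFun ω (t z)` for the Bergman kernel `B^ω_t`. -/
def kernelFun (ω : ℝ → ℝ) (w : ℂ) : ℂ := ∑' n, (kernelCoeff ω n : ℂ) * w ^ n

/-- The function with `K^ω_t(z) = avgKernelFun ω (t z)` for the averaged kernel `K^ω_t`. -/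
def avgKernelFun (ω : ℝ → ℝ) (w : ℂ) : ℂ := ∑' n, (avgCoeff ω n : ℂ) * w ^ n

namespace IsRadialWeight

variable {ω : ℝ → ℝ}

lemma hasPowerSeriesOnDisc_kernelFun (hω : IsRadialWeight ω) :
    HasPowerSeriesOnDisc (fun n => kernelCoeff ω n) (kernelFun ω) :=
  hasPowerSeriesOnDisc_tsum fun ρ hρ => by
    simpa [abs_of_pos (hω.kernelCoeff_pos _)] using hω.summable_kernelCoeff hρ

lemma hasPowerSeriesOnDisc_avgKernelFun (hω : IsRadialWeight ω) :
    HasPowerSeriesOnDisc (fun n => avgCoeff ω n) (avgKernelFun ω) :=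
  hasPowerSeriesOnDisc_tsum fun ρ hρ => by
    simpa [abs_of_nonneg (hω.avgCoeff_nonneg _)] using hω.summable_avgCoeff hρ

lemma bergmanKernel_eq (hω : IsRadialWeight ω) {t : ℝ} (ht : t ∈ Ico (0 : ℝ) 1) {z : ℂ}
    (hz : z ∈ disc) : bergmanKernel ω t z = kernelFun ω (t * z) := by
  have htz := mul_mem_disc (norm_ofReal_le_one (Ico_subset_Icc_self ht)) hz
  refine (hω.hasPowerSeriesOnDisc_bergmanKernel ht z hz).unique ?_
  simpa only [mul_pow, mul_assoc] using hω.hasPowerSeriesOnDisc_kernelFun _ htz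

lemma integral_kernelFun (hω : IsRadialWeight ω) {w : ℂ} (hw : w ∈ disc) :
    ∫ s in (0 : ℝ)..1, kernelFun ω (s * w) = avgKernelFun ω w := by
  refine (hω.hasPowerSeriesOnDisc_kernelFun.hasSum_integral hw).unique ?_
  simpa [avgCoeff] using hω.hasPowerSeriesOnDisc_avgKernelFun w hw

lemma averagedKernel_eq (hω : IsRadialWeight ω) {t : ℝ} (ht : t ∈ Ico (0 : ℝ) 1) {z : ℂ}
    (hz : z ∈ disc) : averagedKernel ω t z = avgKernelFun ω (t * z) := by
  rw [← hω.integral_kernelFun (mul_mem_disc (norm_ofReal_le_one (Ico_subset_Icc_self ht)) hz),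
    averagedKernel]
  split_ifs with h
  · simp [h, hω.bergmanKernel_eq ht (h ▸ hz)]
  · rw [intervalIntegral.integral_mul_const, one_div, mul_comm _ z, inv_mul_cancel_left₀ h]
    refine intervalIntegral.integral_congr fun s hs => ?_
    rw [uIcc_of_le zero_le_one] at hs
    rw [hω.bergmanKernel_eq ht (mul_mem_disc (norm_ofReal_le_one hs) hz), mul_left_comm]

lemma hasPowerSeriesOnDisc_one_sub_mul_kernelFun (hω : IsRadialWeight ω) :
    HasPowerSeriesOnDisc (fun n => kernelDiff ω n) fun w => (1 - w) * kernelFun ω w := by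
  intro w hw
  have h := hω.hasPowerSeriesOnDisc_kernelFun w hw
  rw [← hasSum_nat_add_iff' 1]
  convert ((hasSum_nat_add_iff' 1).2 h).sub (h.mul_left w) using 1
  · ext n
    simp only [kernelDiff]
    push_cast
    ring
  · simp only [Finset.sum_range_one, kernelDiff, pow_zero]
    ring

end IsRadialWeight

namespace IsUpperDoubling

variable {ω : ℝ → ℝ}

-- Multiplying `kernelFun` by `1 - z` turns its coefficients into differences, which are smaller by
-- a factor `1 / n`; this makes the product accessible to Parseval's identity.
lemma exists_circleAverage_kernelFun_le (hω : IsUpperDoubling ω) :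
    ∃ D : ℝ, 0 < D ∧ ∀ σ ∈ Ico (0 : ℝ) 1,
      circleAverage (fun z => ‖kernelFun ω z‖) 0 σ ≤ D * tailWeight ω σ / (1 - σ) := by
  obtain ⟨D, hD, hdiff⟩ := hω.exists_abs_kernelDiff_mul_pow_le
  refine ⟨D ^ 2 + 1 / 2, by positivity, fun σ hσ => ?_⟩
  have hσ1 : 0 < 1 - σ := sub_pos.2 hσ.2
  have hW : 0 < tailWeight ω σ := one_pos.trans_le (hω.radialWeight.one_le_tailWeight hσ)
  have hF := hω.radialWeight.hasPowerSeriesOnDisc_one_sub_mul_kernelFun.onCircle hσ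
  have hG := (hasPowerSeriesOnDisc_inv_one_sub_mul (c := 1) norm_one.le).onCircle hσ
  have hFsq := hF.circleAverage_norm_sq_le (one_add_div_two_mem hσ) fun n => by
    simpa using hdiff σ hσ n
  have hGsq := circleAverage_norm_inv_one_sub_mul_sq_le (c := 1) norm_one.le hσ
  have hfactor : EqOn (fun z => ‖kernelFun ω z‖)
      (fun z => ‖(1 - z) * kernelFun ω z * (1 - 1 * z)⁻¹‖) (Metric.sphere 0 |σ|) := by
    intro z hz
    have hz1 : 1 - z ≠ 0 := by
      rw [mem_sphere_zero_iff_norm, abs_of_nonneg hσ.1] at hz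
      refine sub_ne_zero.2 fun h => hσ.2.ne ?_
      rw [← hz, ← h, norm_one]
    beta_reduce
    rw [one_mul, mul_comm (1 - z), mul_inv_cancel_right₀ hz1]
  rw [Real.circleAverage_congr_sphere hfactor]
  set W := tailWeight ω σ
  calc _ ≤ _ := circleAverage_norm_mul_le hσ.1 hF.continuousOn hG.continuousOn hW
    _ ≤ 1 / (2 * W) * ((D * W) ^ 2 / (1 - (1 + σ) / 2)) + W / 2 * (1 / (1 - ‖(1 : ℂ)‖ * σ)) := by
      gcongr
    _ = (D ^ 2 + 1 / 2) * W / (1 - σ) := by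
      rw [norm_one, one_mul, show 1 - (1 + σ) / 2 = (1 - σ) / 2 by ring]
      field_simp

lemma exists_circleAverage_kernelFun_dilation_le (hω : IsUpperDoubling ω) {A : ℝ}
    (hA : ∀ a ∈ Ico (0 : ℝ) 1, tailWeight ω a * tail ω a ≤ A * (1 - a)) :
    ∃ D : ℝ, 0 < D ∧ ∀ ρ ∈ Ico (0 : ℝ) 1, ∀ y ∈ Ico (0 : ℝ) 1,
      circleAverage (fun z => ‖kernelFun ω (y * z)‖) 0 ρ ≤ D * (1 / tail ω y) := by
  obtain ⟨B, hB, hmean⟩ := hω.exists_circleAverage_kernelFun_le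
  have h := hω.radialWeight
  have hA0 : 0 < A := by
    have h0 : (0 : ℝ) ∈ Ico (0 : ℝ) 1 := left_mem_Ico.2 one_pos
    have := mul_pos (one_pos.trans_le (h.one_le_tailWeight h0)) (h.tail_pos 0 h0)
    linarith [hA 0 h0]
  refine ⟨B * A, by positivity, fun ρ hρ y hy => ?_⟩
  have hyρ := mul_mem_Ico hy (Ico_subset_Icc_self hρ)
  have hy_tail := h.tail_pos y hy
  have hyρ_tail := h.tail_pos _ hyρ
  have hyρ1 : 0 < 1 - y * ρ := sub_pos.2 hyρ.2
  rw [circleAverage_comp_mul (fun z => ‖kernelFun ω z‖)]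
  calc circleAverage (fun z => ‖kernelFun ω z‖) 0 (y * ρ)
    _ ≤ B * tailWeight ω (y * ρ) / (1 - y * ρ) := hmean _ hyρ
    _ ≤ B * A * (1 / tail ω (y * ρ)) := by
      rw [mul_one_div, div_le_div_iff₀ hyρ1 hyρ_tail]
      linarith [mul_le_mul_of_nonneg_left (hA _ hyρ) hB.le]
    _ ≤ B * A * (1 / tail ω y) := by
      gcongr
      exact h.tail_anti hyρ.1 (mul_le_of_le_one_right hy.1 hρ.2.le) hy.2.le

end IsUpperDoubling

lemma IsRadialWeight.ofReal_circleAverage_avgKernelFun_le {ω : ℝ → ℝ} (hω : IsRadialWeight ω)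
    {ρ t : ℝ} (hρ : ρ ∈ Ico (0 : ℝ) 1) (ht : t ∈ Ico (0 : ℝ) 1) :
    ENNReal.ofReal (circleAverage (fun z => ‖avgKernelFun ω (t * z)‖) 0 ρ) ≤
      ∫⁻ s in Ioc (0 : ℝ) 1,
        ENNReal.ofReal (circleAverage (fun z => ‖kernelFun ω ((t * s : ℝ) * z)‖) 0 ρ) := by
  have hkernel := hω.hasPowerSeriesOnDisc_kernelFun.differentiableOn.continuousOn
  have havg := hω.hasPowerSeriesOnDisc_avgKernelFun.differentiableOn.continuousOn
  have hdisc {y : ℝ} (hy : y ∈ Ico (0 : ℝ) 1) {z : ℂ} (hz : ‖z‖ = ρ) : (y : ℂ) * z ∈ disc :=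
    mul_mem_disc (norm_ofReal_le_one (Ico_subset_Icc_self hy)) (mem_disc.2 (hz ▸ hρ.2))
  have hts {s : ℝ} (hs : s ∈ Ioc (0 : ℝ) 1) : t * s ∈ Ico (0 : ℝ) 1 :=
    mul_mem_Ico ht (Ioc_subset_Icc_self hs)
  refine ofReal_circleAverage_norm_integral_le (Φ := fun s z => kernelFun ω ((t * s : ℝ) * z)) hρ.1
    (havg.comp (by fun_prop) fun z hz => hdisc ht (mem_sphere_zero_iff_norm.1 hz))
    (ae_restrict_of_forall_mem measurableSet_Ioc fun s hs =>
      hkernel.comp (by fun_prop) fun z hz => hdisc (hts hs) (mem_sphere_zero_iff_norm.1 hz))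
    ?_ fun z hz => ?_
  · rw [Measure.prod_restrict]
    refine ContinuousOn.aestronglyMeasurable ?_ (measurableSet_Ioc.prod measurableSet_Ioc)
    have := continuous_circleMap 0 ρ
    exact hkernel.comp (by fun_prop) fun p hp =>
      hdisc (hts hp.1) (mem_sphere_zero_iff_norm.1 (circleMap_mem_sphere 0 hρ.1 _))
  · rw [← hω.integral_kernelFun (hdisc ht hz), intervalIntegral.integral_of_le zero_le_one]
    refine setIntegral_congr_fun measurableSet_Ioc fun s _ => ?_
    push_cast
    congr 1
    ring

lemma IsUpperDoubling.exists_circleAverage_avgKernelFun_le {ω : ℝ → ℝ} (hω : IsUpperDoubling ω)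
    {A : ℝ} (hA : ∀ a ∈ Ico (0 : ℝ) 1, tailWeight ω a * tail ω a ≤ A * (1 - a)) :
    ∃ D : ℝ≥0, ∀ ρ ∈ Ico (0 : ℝ) 1, ∀ t ∈ Ico (0 : ℝ) 1,
      ENNReal.ofReal (circleAverage (fun z => ‖avgKernelFun ω (t * z)‖) 0 ρ) ≤
        D * ENNReal.ofReal (tailWeight ω t) := by
  obtain ⟨B, hB, hmean⟩ := hω.exists_circleAverage_kernelFun_dilation_le hA
  have h := hω.radialWeight
  obtain ⟨K, hK, hinv⟩ := h.exists_integral_inv_tail_mul_le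
  refine ⟨(B * K).toNNReal, fun ρ hρ t ht => ?_⟩
  have hint : IntegrableOn (fun s => B * (1 / tail ω (t * s))) (Ioc 0 1) :=
    ((intervalIntegrable_iff_integrableOn_Ioc_of_le zero_le_one).1
      (h.intervalIntegrable_inv_tail_mul ht)).const_mul B
  calc ENNReal.ofReal (circleAverage (fun z => ‖avgKernelFun ω (t * z)‖) 0 ρ)
    _ ≤ ∫⁻ s in Ioc (0 : ℝ) 1,
        ENNReal.ofReal (circleAverage (fun z => ‖kernelFun ω ((t * s : ℝ) * z)‖) 0 ρ) :=
      h.ofReal_circleAverage_avgKernelFun_le hρ ht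
    _ ≤ ∫⁻ s in Ioc (0 : ℝ) 1, ENNReal.ofReal (B * (1 / tail ω (t * s))) :=
      setLIntegral_mono' measurableSet_Ioc fun s hs =>
        ENNReal.ofReal_le_ofReal (hmean ρ hρ _ (mul_mem_Ico ht (Ioc_subset_Icc_self hs)))
    _ = ENNReal.ofReal (B * ∫ s in (0 : ℝ)..1, 1 / tail ω (t * s)) := by
      rw [← intervalIntegral.integral_const_mul, intervalIntegral.integral_of_le zero_le_one,
        ofReal_integral_eq_lintegral_ofReal hint
          (ae_restrict_of_forall_mem measurableSet_Ioc fun s hs =>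
            mul_nonneg hB.le (h.inv_tail_mul_nonneg ht (Ioc_subset_Icc_self hs)))]
    _ ≤ ENNReal.ofReal (B * K * tailWeight ω t) := by
      refine ENNReal.ofReal_le_ofReal ?_
      rw [mul_assoc]
      exact mul_le_mul_of_nonneg_left (hinv t ht) hB.le
    _ = (B * K).toNNReal * ENNReal.ofReal (tailWeight ω t) :=
      ENNReal.ofReal_mul (by positivity)

/-! ### Radial Carleson measures and test functions -/

lemma isRadialCarleson_iff {ν : Measure ℝ} {A : ℝ≥0} :
    IsRadialCarleson ν A ↔
      ∀ a ∈ Ico (0 : ℝ) 1, ENNReal.ofReal (1 / (1 - a)) * ν (Ico a 1) ≤ A := by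
  refine forall₂_congr fun a ha => ?_
  have ha1 : 0 < 1 - a := sub_pos.2 ha.2
  rw [one_div, ENNReal.ofReal_inv_of_pos ha1, mul_comm _ (ν _), ← div_eq_mul_inv,
    ENNReal.div_le_iff (by simpa using ha1) ENNReal.ofReal_ne_top]

lemma exists_isRadialCarleson_iff {ν : Measure ℝ} :
    (∃ A, IsRadialCarleson ν A) ↔
      ⨆ a ∈ Ico (0 : ℝ) 1, ENNReal.ofReal (1 / (1 - a)) * ν (Ico a 1) < ⊤ := by
  simp_rw [isRadialCarleson_iff, ← iSup₂_le_iff]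
  exact ⟨fun ⟨A, hA⟩ => hA.trans_lt ENNReal.coe_lt_top,
    fun h => ⟨_, (ENNReal.coe_toNNReal h.ne).ge⟩⟩

/-- The functions `(1 - a) / (1 - a z)²`, which lie in the unit ball of `H¹` and are of size
`1 / (1 - a)` on `[a,1)`. -/
def testFun (a : ℝ) (z : ℂ) : ℂ := (1 - a) / (1 - a * z) ^ 2

lemma testFun_ofReal (a t : ℝ) : testFun a t = (((1 - a) / (1 - a * t) ^ 2 : ℝ) : ℂ) := by
  simp [testFun]

lemma testFun_ofReal_eq_norm {a : ℝ} (ha : a ≤ 1) (t : ℝ) : testFun a t = ‖testFun a t‖ := by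
  rw [testFun_ofReal, Complex.norm_of_nonneg (div_nonneg (sub_nonneg.2 ha) (sq_nonneg _))]

section TestFun

variable {a : ℝ}

lemma differentiableOn_testFun (ha : a ∈ Ico (0 : ℝ) 1) :
    DifferentiableOn ℂ (testFun a) disc := by
  refine DifferentiableOn.div (by fun_prop) (by fun_prop) fun z hz => pow_ne_zero 2 ?_
  refine sub_ne_zero.2 fun h => ?_
  have hdisc := mul_mem_disc (norm_ofReal_le_one (Ico_subset_Icc_self ha)) hz
  rw [mem_disc, ← h, norm_one] at hdisc
  exact hdisc.false

lemma norm_testFun (ha : a ≤ 1) (z : ℂ) : ‖testFun a z‖ = (1 - a) * ‖(1 - a * z)⁻¹‖ ^ 2 := by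
  have hnorm : ‖(1 : ℂ) - a‖ = 1 - a := by
    rw [← Complex.ofReal_one, ← Complex.ofReal_sub, Complex.norm_of_nonneg (sub_nonneg.2 ha)]
  rw [testFun, norm_div, norm_pow, norm_inv, hnorm, inv_pow, div_eq_mul_inv]

lemma hardyNorm_testFun_le (ha : a ∈ Ico (0 : ℝ) 1) : hardyNorm (testFun a) ≤ 1 := by
  refine iSup₂_le fun ρ hρ => ENNReal.ofReal_le_one.2 ?_
  have hsq := circleAverage_norm_inv_one_sub_mul_sq_le
    (norm_ofReal_le_one (Ico_subset_Icc_self ha)) (Ioo_subset_Ico_self hρ)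
  rw [Complex.norm_of_nonneg ha.1] at hsq
  have ha1 : 0 < 1 - a := sub_pos.2 ha.2
  have haρ : 1 - a ≤ 1 - a * ρ := sub_le_sub_left (mul_le_of_le_one_right ha.1 hρ.2.le) 1
  simp only [norm_testFun ha.2.le, ← smul_eq_mul (1 - a), Real.circleAverage_fun_smul]
  calc (1 - a) * circleAverage (fun z => ‖(1 - a * z)⁻¹‖ ^ 2) 0 ρ
    _ ≤ (1 - a) * (1 / (1 - a * ρ)) := by gcongr
    _ ≤ 1 := by rw [mul_one_div]; exact div_le_one_of_le₀ haρ (ha1.le.trans haρ)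

lemma memHardy_testFun (ha : a ∈ Ico (0 : ℝ) 1) : MemHardy (testFun a) :=
  ⟨differentiableOn_testFun ha, (hardyNorm_testFun_le ha).trans_lt ENNReal.one_lt_top⟩

lemma one_div_one_sub_le_norm_testFun (ha : a ∈ Ico (0 : ℝ) 1) {t : ℝ} (ht : t ∈ Ico a 1) :
    1 / (1 - a) ≤ 4 * ‖testFun a t‖ := by
  have ha1 : 0 < 1 - a := sub_pos.2 ha.2
  have hlower : 1 - a ≤ 1 - a * t := sub_le_sub_left (mul_le_of_le_one_right ha.1 ht.2.le) 1
  have hupper : 1 - a * t ≤ 2 * (1 - a) := by nlinarith [ha.1, ha.2, ht.1]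
  have hsq : (1 - a * t) ^ 2 ≤ (2 * (1 - a)) ^ 2 :=
    pow_le_pow_left₀ (ha1.le.trans hlower) hupper 2
  have hpos : 0 < (1 - a * t) ^ 2 := pow_pos (ha1.trans_le hlower) 2
  rw [testFun_ofReal, Complex.norm_of_nonneg (div_nonneg ha1.le hpos.le), ← mul_div_assoc,
    div_le_div_iff₀ ha1 hpos]
  linarith

end TestFun

lemma exists_isRadialCarleson_of_setLIntegral_testFun_le {ν : Measure ℝ} {C : ℝ≥0}
    (h : ∀ a ∈ Ico (0 : ℝ) 1, ∫⁻ t in Ico (0 : ℝ) 1, ‖testFun a t‖ₑ ∂ν ≤ C) :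
    ∃ A, IsRadialCarleson ν A := by
  refine ⟨4 * C, isRadialCarleson_iff.2 fun a ha => ?_⟩
  calc ENNReal.ofReal (1 / (1 - a)) * ν (Ico a 1)
    _ = ∫⁻ t in Ico a 1, ENNReal.ofReal (1 / (1 - a)) ∂ν := (setLIntegral_const _ _).symm
    _ ≤ ∫⁻ t in Ico a 1, 4 * ‖testFun a t‖ₑ ∂ν := by
      refine setLIntegral_mono' measurableSet_Ico fun t ht => ?_
      refine (ENNReal.ofReal_le_ofReal (one_div_one_sub_le_norm_testFun ha ht)).trans_eq ?_
      rw [ENNReal.ofReal_mul zero_le_four, ofReal_norm, ENNReal.ofReal_ofNat]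
    _ ≤ ∫⁻ t in Ico (0 : ℝ) 1, 4 * ‖testFun a t‖ₑ ∂ν :=
      lintegral_mono_set (Ico_subset_Ico_left ha.1)
    _ = 4 * ∫⁻ t in Ico (0 : ℝ) 1, ‖testFun a t‖ₑ ∂ν :=
      lintegral_const_mul' _ _ (by norm_num)
    _ ≤ (4 * C : ℝ≥0) := by
      push_cast
      gcongr
      exact h a ha

lemma measurableEmbedding_ofReal : MeasurableEmbedding (fun t : ℝ => (t : ℂ)) :=
  Complex.isometry_ofReal.isClosedEmbedding.measurableEmbedding

theorem isCarlesonForHardy_one_map_ofReal_iff {ν : Measure ℝ} :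
    IsCarlesonForHardy 1 ((ν.restrict (Ico 0 1)).map fun t : ℝ => (t : ℂ)) ↔
      ∃ A, IsRadialCarleson ν A := by
  have hnorm (f : ℂ → ℂ) : eLpNorm f 1 ((ν.restrict (Ico 0 1)).map fun t : ℝ => (t : ℂ)) =
      ∫⁻ t in Ico (0 : ℝ) 1, ‖f t‖ₑ ∂ν := by
    rw [eLpNorm_one_eq_lintegral_enorm, measurableEmbedding_ofReal.lintegral_map]
  constructor
  · rintro ⟨C, hC⟩
    refine exists_isRadialCarleson_of_setLIntegral_testFun_le (C := C) fun a ha => ?_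
    rw [← hnorm]
    exact (hC _ (memHardy_testFun ha)).2.trans
      (mul_le_of_le_one_right' (hardyNorm_testFun_le ha))
  · rintro ⟨A, hA⟩
    refine ⟨8 * A, fun f hf => ?_⟩
    have hle := hA.setLIntegral_enorm_le_hardyNorm hf.analytic
    rw [← hnorm] at hle
    exact ⟨⟨measurableEmbedding_ofReal.aestronglyMeasurable_map_iff.2
      ((continuousOn_comp_ofReal hf.analytic).aestronglyMeasurable measurableSet_Ico),
      hle.trans_lt (ENNReal.mul_lt_top ENNReal.coe_lt_top hf.norm_lt_top)⟩, hle⟩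

/-- The measure on the line with density `carlesonDensity ω`; `radialMeasure ω` is the image of its
part on `[0,1)`. -/
def carlesonMeasure (ω : ℝ → ℝ) : Measure ℝ :=
  volume.withDensity fun t => ENNReal.ofReal (carlesonDensity ω t)

lemma carlesonMeasure_Ico (ω : ℝ → ℝ) (a : ℝ) :
    carlesonMeasure ω (Ico a 1) = ∫⁻ t in Ico a 1, ENNReal.ofReal (carlesonDensity ω t) :=
  withDensity_apply _ measurableSet_Ico

lemma radialMeasure_eq (ω : ℝ → ℝ) :
    radialMeasure ω = ((carlesonMeasure ω).restrict (Ico 0 1)).map fun t : ℝ => (t : ℂ) := by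
  rw [carlesonMeasure, restrict_withDensity measurableSet_Ico, radialMeasure]

/-! ### The Hilbert-type operator -/

lemma integrableOn_comp_mul {k : ℂ → ℂ} (hk : DifferentiableOn ℂ k disc)
    {g : ℝ → ℂ} (hg : IntegrableOn g (Ico 0 1)) {z : ℂ} (hz : z ∈ disc) :
    IntegrableOn (fun t : ℝ => k (t * z) * g t) (Ico 0 1) := by
  rw [← integrableOn_Icc_iff_integrableOn_Ico] at hg ⊢
  exact hg.continuousOn_mul (hk.continuousOn.comp (by fun_prop) fun t ht =>
    mul_mem_disc (norm_ofReal_le_one ht) hz) isCompact_Icc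

lemma HasPowerSeriesOnDisc.setIntegral_comp_mul {a : ℕ → ℂ} {k : ℂ → ℂ}
    (H : HasPowerSeriesOnDisc a k) {g : ℝ → ℂ} (hg : IntegrableOn g (Ico 0 1)) :
    HasPowerSeriesOnDisc (fun n => a n * ∫ t in Ico (0 : ℝ) 1, (t : ℂ) ^ n * g t)
      fun z => ∫ t in Ico (0 : ℝ) 1, k (t * z) * g t := by
  intro z hz
  have hmoment (n : ℕ) : IntegrableOn (fun t : ℝ => (t : ℂ) ^ n * g t) (Ico 0 1) := by
    rw [← integrableOn_Icc_iff_integrableOn_Ico] at hg ⊢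
    exact hg.continuousOn_mul (by fun_prop) isCompact_Icc
  have hnorm (n : ℕ) :
      ∫ t in Ico (0 : ℝ) 1, ‖(t : ℂ) ^ n * g t‖ ≤ ∫ t in Ico (0 : ℝ) 1, ‖g t‖ := by
    refine setIntegral_mono_on (hmoment n).norm hg.norm measurableSet_Ico fun t ht => ?_
    rw [norm_mul, norm_pow]
    exact mul_le_of_le_one_left (norm_nonneg _)
      (pow_le_one₀ (norm_nonneg _) (norm_ofReal_le_one (Ico_subset_Icc_self ht)))
  have hsum := hasSum_integral_of_summable_integral_norm
    (F := fun n (t : ℝ) => a n * ((t : ℂ) ^ n * g t) * z ^ n)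
    (fun n => ((hmoment n).const_mul _).mul_const _) (by
      simp_rw [norm_mul _ (z ^ _), norm_mul (a _), integral_mul_const, integral_const_mul,
        mul_right_comm, norm_pow]
      exact .of_nonneg_of_le (fun n => by positivity)
        (fun n => mul_le_mul_of_nonneg_left (hnorm n) (by positivity))
        ((H.summable_norm ⟨norm_nonneg z, mem_disc.1 hz⟩).mul_right _))
  simp_rw [integral_mul_const, integral_const_mul] at hsum
  have hvalue : ∫ t in Ico (0 : ℝ) 1, ∑' n, a n * ((t : ℂ) ^ n * g t) * z ^ n =
      ∫ t in Ico (0 : ℝ) 1, k (t * z) * g t := by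
    refine setIntegral_congr_fun measurableSet_Ico fun t ht => ?_
    have htz := mul_mem_disc (norm_ofReal_le_one (Ico_subset_Icc_self ht)) hz
    simp only [← (H _ htz).tsum_eq, ← tsum_mul_right, mul_pow]
    exact tsum_congr fun n => by ring
  rwa [hvalue] at hsum

namespace IsRadialWeight

variable {ω : ℝ → ℝ} {f : ℂ → ℂ}

lemma hilbertIntegrand_eq (hω : IsRadialWeight ω) (f : ℂ → ℂ) {z : ℂ} (hz : z ∈ disc) {t : ℝ}
    (ht : t ∈ Ico (0 : ℝ) 1) :
    hilbertIntegrand ω f z t = avgKernelFun ω (t * z) * (f t * ω t) := by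
  rw [hilbertIntegrand, hω.averagedKernel_eq ht hz, mul_comm (f t), mul_assoc]

lemma hilbertOp_eq (hω : IsRadialWeight ω) (f : ℂ → ℂ) {z : ℂ} (hz : z ∈ disc) :
    hilbertOp ω f z = ∫ t in Ico (0 : ℝ) 1, avgKernelFun ω (t * z) * (f t * ω t) :=
  setIntegral_congr_fun measurableSet_Ico fun _ ht => hω.hilbertIntegrand_eq f hz ht

lemma integrableOn_hilbertIntegrand (hω : IsRadialWeight ω)
    (hf : IntegrableOn (fun t : ℝ => f t * ω t) (Ico 0 1)) {z : ℂ} (hz : z ∈ disc) :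
    IntegrableOn (hilbertIntegrand ω f z) (Ico 0 1) :=
  (integrableOn_comp_mul hω.hasPowerSeriesOnDisc_avgKernelFun.differentiableOn hf hz).congr_fun
    (fun _ ht => (hω.hilbertIntegrand_eq f hz ht).symm) measurableSet_Ico

lemma differentiableOn_hilbertOp (hω : IsRadialWeight ω)
    (hf : IntegrableOn (fun t : ℝ => f t * ω t) (Ico 0 1)) :
    DifferentiableOn ℂ (hilbertOp ω f) disc :=
  (hω.hasPowerSeriesOnDisc_avgKernelFun.setIntegral_comp_mul hf).differentiableOn.congr
    fun _ hz => hω.hilbertOp_eq f hz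

lemma aestronglyMeasurable_comp_ofReal_mul (hω : IsRadialWeight ω)
    (hf : ContinuousOn (fun t : ℝ => f t) (Ico 0 1)) :
    AEStronglyMeasurable (fun t : ℝ => f t * ω t) (volume.restrict (Ico 0 1)) :=
  (hf.aestronglyMeasurable measurableSet_Ico).mul
    (Complex.continuous_ofReal.comp_aestronglyMeasurable hω.integrable.1)

lemma setLIntegral_enorm_carlesonMeasure (hω : IsRadialWeight ω) (f : ℂ → ℂ) :
    ∫⁻ t in Ico (0 : ℝ) 1, ‖f t‖ₑ ∂carlesonMeasure ω =
      ∫⁻ t in Ico (0 : ℝ) 1, ‖f t * ω t‖ₑ * ENNReal.ofReal (tailWeight ω t) := by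
  have hmeas : AEMeasurable (fun t => ENNReal.ofReal (carlesonDensity ω t))
      (volume.restrict (Ico 0 1)) :=
    (hω.integrable.1.aemeasurable.mul
      (hω.continuousOn_tailWeight.aemeasurable measurableSet_Ico)).ennreal_ofReal
  rw [carlesonMeasure, restrict_withDensity measurableSet_Ico,
    lintegral_withDensity_eq_lintegral_mul_non_measurable₀ _ hmeas
      (.of_forall fun _ => ENNReal.ofReal_lt_top)]
  refine setLIntegral_congr_fun measurableSet_Ico fun t ht => ?_
  have hωt := hω.nonneg t ht
  change ENNReal.ofReal (ω t * tailWeight ω t) * ‖f t‖ₑ = _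
  rw [ENNReal.ofReal_mul hωt, enorm_mul, ← ofReal_norm (ω t : ℂ), Complex.norm_of_nonneg hωt,
    mul_right_comm, mul_comm ‖f t‖ₑ]

lemma tailWeight_mul_tail_le (hω : IsRadialWeight ω) {A : ℝ≥0}
    (hA : IsRadialCarleson (carlesonMeasure ω) A) {a : ℝ} (ha : a ∈ Ico (0 : ℝ) 1) :
    tailWeight ω a * tail ω a ≤ A * (1 - a) := by
  have hsub : Ico a 1 ⊆ Ico (0 : ℝ) 1 := Ico_subset_Ico_left ha.1
  have hW := zero_le_one.trans (hω.one_le_tailWeight ha)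
  have ha1 : 0 ≤ 1 - a := sub_nonneg.2 ha.2.le
  rw [← ENNReal.ofReal_le_ofReal_iff (mul_nonneg A.coe_nonneg ha1), ENNReal.ofReal_mul A.coe_nonneg,
    ENNReal.ofReal_coe_nnreal]
  calc ENNReal.ofReal (tailWeight ω a * tail ω a)
    _ = ∫⁻ t in Ico a 1, ENNReal.ofReal (tailWeight ω a * ω t) := by
      rw [tail_eq_setIntegral ω ha.2.le, ← integral_const_mul,
        ofReal_integral_eq_lintegral_ofReal ((hω.integrable.mono_set hsub).const_mul _)
          (ae_restrict_of_forall_mem measurableSet_Ico fun t ht =>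
            mul_nonneg hW (hω.nonneg t (hsub ht)))]
    _ ≤ ∫⁻ t in Ico a 1, ENNReal.ofReal (carlesonDensity ω t) := by
      refine setLIntegral_mono' measurableSet_Ico fun t ht => ENNReal.ofReal_le_ofReal ?_
      rw [mul_comm]
      exact mul_le_mul_of_nonneg_left (hω.tailWeight_mono ha.1 ht.1 ht.2) (hω.nonneg t (hsub ht))
    _ = carlesonMeasure ω (Ico a 1) := (carlesonMeasure_Ico ω a).symm
    _ ≤ A * ENNReal.ofReal (1 - a) := hA a ha

lemma integrableOn_mul_of_isRadialCarleson (hω : IsRadialWeight ω) {A : ℝ≥0}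
    (hA : IsRadialCarleson (carlesonMeasure ω) A) (hf : MemHardy f) :
    IntegrableOn (fun t : ℝ => f t * ω t) (Ico 0 1) := by
  refine ⟨hω.aestronglyMeasurable_comp_ofReal_mul (continuousOn_comp_ofReal hf.analytic),
    hasFiniteIntegral_iff_enorm.2 ?_⟩
  calc ∫⁻ t in Ico (0 : ℝ) 1, ‖f t * ω t‖ₑ
    _ ≤ ∫⁻ t in Ico (0 : ℝ) 1, ‖f t * ω t‖ₑ * ENNReal.ofReal (tailWeight ω t) :=
      setLIntegral_mono' measurableSet_Ico fun t ht =>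
        le_mul_of_one_le_right' (ENNReal.one_le_ofReal.2 (hω.one_le_tailWeight ht))
    _ = ∫⁻ t in Ico (0 : ℝ) 1, ‖f t‖ₑ ∂carlesonMeasure ω :=
      (hω.setLIntegral_enorm_carlesonMeasure f).symm
    _ ≤ 8 * A * hardyNorm f := hA.setLIntegral_enorm_le_hardyNorm hf.analytic
    _ < ⊤ := ENNReal.mul_lt_top (by finiteness) hf.norm_lt_top

lemma ofReal_circleAverage_norm_hilbertOp_le (hω : IsRadialWeight ω)
    (hf : IntegrableOn (fun t : ℝ => f t * ω t) (Ico 0 1)) {ρ : ℝ} (hρ : ρ ∈ Ico (0 : ℝ) 1) :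
    ENNReal.ofReal (circleAverage (fun z => ‖hilbertOp ω f z‖) 0 ρ) ≤
      ∫⁻ t in Ico (0 : ℝ) 1, ‖f t * ω t‖ₑ *
        ENNReal.ofReal (circleAverage (fun z => ‖avgKernelFun ω (t * z)‖) 0 ρ) := by
  have hdisc {z : ℂ} (hz : ‖z‖ = ρ) : z ∈ disc := mem_disc.2 (hz.trans_lt hρ.2)
  have hkernel := hω.hasPowerSeriesOnDisc_avgKernelFun.differentiableOn.continuousOn
  refine (ofReal_circleAverage_norm_integral_le (μ := volume.restrict (Ico (0 : ℝ) 1))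
    (Φ := fun t z => avgKernelFun ω (t * z) * (f t * ω t)) hρ.1
    ((hω.differentiableOn_hilbertOp hf).continuousOn.mono fun z hz =>
      hdisc (mem_sphere_zero_iff_norm.1 hz))
    (ae_restrict_of_forall_mem measurableSet_Ico fun t ht => ?_) ?_
    fun z hz => hω.hilbertOp_eq f (hdisc hz)).trans_eq ?_
  · exact (hkernel.comp (by fun_prop) fun z hz => mul_mem_disc
      (norm_ofReal_le_one (Ico_subset_Icc_self ht))
        (hdisc (mem_sphere_zero_iff_norm.1 hz))).mul continuousOn_const
  · refine AEStronglyMeasurable.mul ?_ hf.1.comp_fst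
    rw [Measure.prod_restrict]
    refine ContinuousOn.aestronglyMeasurable ?_ (measurableSet_Ico.prod measurableSet_Ioc)
    have := continuous_circleMap 0 ρ
    exact hkernel.comp (by fun_prop) fun p hp => mul_mem_disc
      (norm_ofReal_le_one (Ico_subset_Icc_self hp.1))
        (hdisc (mem_sphere_zero_iff_norm.1 (circleMap_mem_sphere 0 hρ.1 p.2)))
  · refine lintegral_congr fun t => ?_
    simp only [norm_mul (avgKernelFun ω _), mul_comm _ ‖f t * (ω t : ℂ)‖]
    simp only [← smul_eq_mul (α := ℝ) ‖f t * (ω t : ℂ)‖, Real.circleAverage_fun_smul]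
    rw [smul_eq_mul, ENNReal.ofReal_mul (norm_nonneg _), ofReal_norm]

end IsRadialWeight

theorem IsUpperDoubling.hilbertBoundedOnHardy_of_isRadialCarleson {ω : ℝ → ℝ}
    (hω : IsUpperDoubling ω) {A : ℝ≥0} (hA : IsRadialCarleson (carlesonMeasure ω) A) :
    HilbertBoundedOnHardy ω := by
  have h := hω.radialWeight
  obtain ⟨D, hD⟩ := hω.exists_circleAverage_avgKernelFun_le fun a ha =>
    h.tailWeight_mul_tail_le hA ha
  refine ⟨D * (8 * A), fun f hf => ?_⟩
  have hint := h.integrableOn_mul_of_isRadialCarleson hA hf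
  have hle : hardyNorm (hilbertOp ω f) ≤ (D * (8 * A) : ℝ≥0) * hardyNorm f := by
    refine iSup₂_le fun ρ hρ => ?_
    have hρ' := Ioo_subset_Ico_self hρ
    calc ENNReal.ofReal (circleAverage (fun z => ‖hilbertOp ω f z‖) 0 ρ)
      _ ≤ ∫⁻ t in Ico (0 : ℝ) 1, ‖f t * ω t‖ₑ *
          ENNReal.ofReal (circleAverage (fun z => ‖avgKernelFun ω (t * z)‖) 0 ρ) :=
        h.ofReal_circleAverage_norm_hilbertOp_le hint hρ'
      _ ≤ ∫⁻ t in Ico (0 : ℝ) 1, D * (‖f t * ω t‖ₑ * ENNReal.ofReal (tailWeight ω t)) :=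
        setLIntegral_mono' measurableSet_Ico fun t ht =>
          (mul_le_mul_right (hD ρ hρ' t ht) _).trans_eq (mul_left_comm _ _ _)
      _ = D * ∫⁻ t in Ico (0 : ℝ) 1, ‖f t‖ₑ ∂carlesonMeasure ω := by
        rw [lintegral_const_mul' _ _ ENNReal.coe_ne_top, h.setLIntegral_enorm_carlesonMeasure]
      _ ≤ D * (8 * A * hardyNorm f) := by
        gcongr
        exact hA.setLIntegral_enorm_le_hardyNorm hf.analytic
      _ = (D * (8 * A) : ℝ≥0) * hardyNorm f := by
        push_cast
        ring
  exact ⟨fun z hz => h.integrableOn_hilbertIntegrand hint hz,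
    ⟨h.differentiableOn_hilbertOp hint,
      hle.trans_lt (ENNReal.mul_lt_top ENNReal.coe_lt_top hf.norm_lt_top)⟩, hle⟩

lemma avgKernelFun_ofReal (ω : ℝ → ℝ) (y : ℝ) :
    avgKernelFun ω y = ((∑' n, avgCoeff ω n * y ^ n : ℝ) : ℂ) := by
  simp [avgKernelFun, Complex.ofReal_tsum]

namespace IsRadialWeight

variable {ω : ℝ → ℝ} {f : ℂ → ℂ}

lemma avgKernelFun_ofReal_eq_norm (hω : IsRadialWeight ω) {y : ℝ} (hy : 0 ≤ y) :
    avgKernelFun ω y = ‖avgKernelFun ω y‖ := by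
  rw [avgKernelFun_ofReal, Complex.norm_of_nonneg
    (tsum_nonneg fun n => mul_nonneg (hω.avgCoeff_nonneg n) (pow_nonneg hy n))]

lemma enorm_hilbertOp_ofReal (hω : IsRadialWeight ω)
    (hf : ∀ t ∈ Ico (0 : ℝ) 1, f t = ‖f t‖) {x : ℝ} (hx : x ∈ Ico (0 : ℝ) 1)
    (hint : IntegrableOn (hilbertIntegrand ω f x) (Ico 0 1)) :
    ‖hilbertOp ω f x‖ₑ =
      ∫⁻ t in Ico (0 : ℝ) 1, ‖avgKernelFun ω (t * x)‖ₑ * ‖f t * ω t‖ₑ := by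
  have heq : ∀ t ∈ Ico (0 : ℝ) 1, hilbertIntegrand ω f x t = ‖hilbertIntegrand ω f x t‖ := by
    intro t ht
    have hk := hω.avgKernelFun_ofReal_eq_norm (mul_nonneg ht.1 hx.1)
    rw [Complex.ofReal_mul] at hk
    rw [hω.hilbertIntegrand_eq f (ofReal_mem_disc hx) ht, norm_mul, norm_mul,
      Complex.norm_of_nonneg (hω.nonneg t ht), Complex.ofReal_mul, Complex.ofReal_mul, ← hk,
      ← hf t ht]
  rw [hilbertOp, setIntegral_congr_fun measurableSet_Ico heq, integral_complex_ofReal,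
    ← ofReal_norm, Complex.norm_of_nonneg (integral_nonneg fun _ => norm_nonneg _),
    ofReal_integral_norm_eq_lintegral_enorm hint]
  refine setLIntegral_congr_fun measurableSet_Ico fun t ht => ?_
  rw [hω.hilbertIntegrand_eq f (ofReal_mem_disc hx) ht, enorm_mul]

lemma ofReal_tailWeight_le_setLIntegral (hω : IsRadialWeight ω) {t : ℝ}
    (ht : t ∈ Ico (0 : ℝ) 1) :
    ENNReal.ofReal (tailWeight ω t) ≤ ENNReal.ofReal (tail ω 0 + 1) *
      ∫⁻ x in Ico (0 : ℝ) 1, ENNReal.ofReal (1 / tail ω (t * x)) := by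
  have h0 := hω.tail_pos 0 (left_mem_Ico.2 one_pos)
  have hint := hω.intervalIntegrable_inv_tail_mul ht
  rw [intervalIntegrable_iff_integrableOn_Ico_of_le zero_le_one] at hint
  rw [← ofReal_integral_eq_lintegral_ofReal hint
      (ae_restrict_of_forall_mem measurableSet_Ico fun x hx =>
        hω.inv_tail_mul_nonneg ht (Ico_subset_Icc_self hx)),
    integral_Ico_eq_integral_Ioc, ← intervalIntegral.integral_of_le zero_le_one,
    ← ENNReal.ofReal_mul (by linarith)]
  exact ENNReal.ofReal_le_ofReal (hω.tailWeight_le_integral_inv_tail_mul ht)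

lemma aemeasurable_inv_tail_mul (hω : IsRadialWeight ω) :
    AEMeasurable (fun p : ℝ × ℝ => ENNReal.ofReal (1 / tail ω (p.1 * p.2)))
      ((volume.restrict (Ico (0 : ℝ) 1)).prod (volume.restrict (Ico (0 : ℝ) 1))) := by
  rw [Measure.prod_restrict]
  refine (ContinuousOn.aemeasurable ?_ (measurableSet_Ico.prod measurableSet_Ico)).ennreal_ofReal
  exact hω.continuousOn_inv_tail.comp (f := fun p : ℝ × ℝ => p.1 * p.2) (by fun_prop)
    fun p hp => mul_mem_Ico hp.1 (Ico_subset_Icc_self hp.2)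

end IsRadialWeight

namespace IsUpperDoubling

variable {ω : ℝ → ℝ}

lemma exists_inv_tail_le_enorm_avgKernelFun (hω : IsUpperDoubling ω) :
    ∃ K : ℝ≥0, ∀ y ∈ Ico (0 : ℝ) 1,
      ENNReal.ofReal (1 / tail ω y) ≤ K * ‖avgKernelFun ω y‖ₑ := by
  obtain ⟨K, hK0, hK⟩ := hω.exists_inv_tail_le_tsum_avgCoeff
  refine ⟨K.toNNReal, fun y hy => ?_⟩
  refine (ENNReal.ofReal_le_ofReal (hK y hy)).trans ?_
  rw [ENNReal.ofReal_mul hK0.le, avgKernelFun_ofReal, ← ofReal_norm, Complex.norm_real]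
  gcongr
  exacts [le_rfl, Real.le_norm_self _]

-- The factor `tailWeight ω t` of the Carleson density is bounded by `∫_0^1 |K^ω_t(x)| dx`; for
-- `f ≥ 0` there is no cancellation in `H_ω(f)(x)`, and Tonelli's theorem applies.
lemma exists_setLIntegral_carlesonMeasure_le (hω : IsUpperDoubling ω) :
    ∃ K : ℝ≥0, ∀ f : ℂ → ℂ, ContinuousOn (fun t : ℝ => f t) (Ico 0 1) →
      (∀ t ∈ Ico (0 : ℝ) 1, f t = ‖f t‖) →
      (∀ z ∈ disc, IntegrableOn (hilbertIntegrand ω f z) (Ico 0 1)) →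
      ∫⁻ t in Ico (0 : ℝ) 1, ‖f t‖ₑ ∂carlesonMeasure ω ≤
        K * ∫⁻ x in Ico (0 : ℝ) 1, ‖hilbertOp ω f x‖ₑ := by
  have h := hω.radialWeight
  obtain ⟨K, hK⟩ := hω.exists_inv_tail_le_enorm_avgKernelFun
  set T : ℝ≥0 := (tail ω 0 + 1).toNNReal
  refine ⟨T * K, fun f hcont hf hint => ?_⟩
  have hmeas := (h.aestronglyMeasurable_comp_ofReal_mul hcont).enorm.comp_fst.mul
    h.aemeasurable_inv_tail_mul
  calc ∫⁻ t in Ico (0 : ℝ) 1, ‖f t‖ₑ ∂carlesonMeasure ω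
    _ = ∫⁻ t in Ico (0 : ℝ) 1, ‖f t * ω t‖ₑ * ENNReal.ofReal (tailWeight ω t) :=
      h.setLIntegral_enorm_carlesonMeasure f
    _ ≤ ∫⁻ t in Ico (0 : ℝ) 1, T * ∫⁻ x in Ico (0 : ℝ) 1,
        ‖f t * ω t‖ₑ * ENNReal.ofReal (1 / tail ω (t * x)) := by
      refine setLIntegral_mono' measurableSet_Ico fun t ht => ?_
      rw [lintegral_const_mul' _ _ enorm_ne_top, mul_left_comm]
      exact mul_le_mul_right (h.ofReal_tailWeight_le_setLIntegral ht) _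
    _ = T * ∫⁻ x in Ico (0 : ℝ) 1, ∫⁻ t in Ico (0 : ℝ) 1,
        ‖f t * ω t‖ₑ * ENNReal.ofReal (1 / tail ω (t * x)) := by
      rw [lintegral_const_mul' _ _ ENNReal.coe_ne_top, lintegral_lintegral_swap hmeas]
    _ ≤ T * ∫⁻ x in Ico (0 : ℝ) 1, K * ‖hilbertOp ω f x‖ₑ := by
      refine mul_le_mul_right (setLIntegral_mono' measurableSet_Ico fun x hx => ?_) _
      rw [h.enorm_hilbertOp_ofReal hf hx (hint x (ofReal_mem_disc hx)),
        ← lintegral_const_mul' _ _ ENNReal.coe_ne_top]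
      refine setLIntegral_mono' measurableSet_Ico fun t ht => ?_
      have hle := hK _ (mul_mem_Ico ht (Ico_subset_Icc_self hx))
      rw [Complex.ofReal_mul] at hle
      exact (mul_le_mul_right hle _).trans_eq (by ring)
    _ = (T * K : ℝ≥0) * ∫⁻ x in Ico (0 : ℝ) 1, ‖hilbertOp ω f x‖ₑ := by
      rw [lintegral_const_mul' _ _ ENNReal.coe_ne_top, ENNReal.coe_mul, mul_assoc]

theorem exists_isRadialCarleson_of_hilbertBoundedOnHardy (hω : IsUpperDoubling ω)
    (h : HilbertBoundedOnHardy ω) : ∃ A, IsRadialCarleson (carlesonMeasure ω) A := by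
  obtain ⟨B, hB⟩ := h
  obtain ⟨K, hK⟩ := hω.exists_setLIntegral_carlesonMeasure_le
  refine exists_isRadialCarleson_of_setLIntegral_testFun_le (C := K * (8 * B)) fun a ha => ?_
  obtain ⟨hint, hmem, hle⟩ := hB _ (memHardy_testFun ha)
  have hvolume : IsRadialCarleson volume 1 := fun b _ => by simp
  have hfejerRiesz := hvolume.setLIntegral_enorm_le_hardyNorm hmem.analytic
  rw [ENNReal.coe_one, mul_one] at hfejerRiesz
  calc ∫⁻ t in Ico (0 : ℝ) 1, ‖testFun a t‖ₑ ∂carlesonMeasure ω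
    _ ≤ K * ∫⁻ x in Ico (0 : ℝ) 1, ‖hilbertOp ω (testFun a) x‖ₑ :=
      hK _ (continuousOn_comp_ofReal (differentiableOn_testFun ha))
        (fun t _ => testFun_ofReal_eq_norm ha.2.le t) hint
    _ ≤ K * (8 * (B * hardyNorm (testFun a))) := by
      gcongr
      exact hfejerRiesz.trans (by gcongr)
    _ ≤ (K * (8 * B) : ℝ≥0) := by
      push_cast
      gcongr
      exact mul_le_of_le_one_right' (hardyNorm_testFun_le ha)

theorem hilbertBoundedOnHardy_iff (hω : IsUpperDoubling ω) :
    HilbertBoundedOnHardy ω ↔ ∃ A, IsRadialCarleson (carlesonMeasure ω) A :=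
  ⟨hω.exists_isRadialCarleson_of_hilbertBoundedOnHardy,
    fun ⟨_, hA⟩ => hω.hilbertBoundedOnHardy_of_isRadialCarleson hA⟩

end IsUpperDoubling

end HilbertType

end

theorem theorem2 (ω : ℝ → ℝ) (hω : HilbertType.IsUpperDoubling ω) :
    List.TFAE
      [HilbertType.HilbertBoundedOnHardy ω,
       HilbertType.IsCarlesonForHardy 1 (HilbertType.radialMeasure ω),
       (⨆ a ∈ Set.Ico (0 : ℝ) 1,
          ENNReal.ofReal (1 / (1 - a)) *
            ∫⁻ t in Set.Ico a 1, ENNReal.ofReal (HilbertType.carlesonDensity ω t)) < ⊤] := by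
  tfae_have 1 ↔ 2 := by
    rw [HilbertType.radialMeasure_eq, HilbertType.isCarlesonForHardy_one_map_ofReal_iff,
      hω.hilbertBoundedOnHardy_iff]
  tfae_have 1 ↔ 3 := by
    rw [hω.hilbertBoundedOnHardy_iff, HilbertType.exists_isRadialCarleson_iff]
    simp only [HilbertType.carlesonMeasure_Ico]
  tfae_finish
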